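/- Let $\psi$ be the Dirichlet character modulo $5$ with $\psi(2)=-1$, and for $s\in\mathbb C$ and real $\tau$ put $$f(s,\tau)=(1-\tau)\left(1+\frac{\sqrt5}{5^{s}}\right)\zeta(s)+\tau L(s,\psi),$$ where $\zeta(s)$ and $L(s,\psi)$ denote the (meromorphically continued) Riemann zeta-function and Dirichlet $L$-function. For a function $g(s,\tau)$, a zero trajectory of $g$ on $(\tau_0-\theta,\tau_0+\theta)$, $\theta>0$, is a continuous function $\rho:(\tau_0-\theta,\tau_0+\theta)\to\mathbb C$ such that $\rho(\tau)$ is a zero of $g(\cdot,\tau)$ for every $\tau\in(\tau_0-\theta,\tau_0+\theta)$. There is an absolute constant $T_0$ such that the following holds. Let $\tau_0\in[0,1]$ and let $\rho_0$ be a zero of order exactly two of $s\mapsto f(s,\tau_0)$ with $\Re\rho_0=1/2$ and $\Im\rho_0>T_0$. Then the following two statements are equivalent. 1) There are $\theta>0$ and a zero trajectory $\rho(\tau)$, $\tau\in(\tau_0-\theta,\tau_0+\theta)$, of $f(s,\tau)$ such that (i) $\rho(\tau_0)=\rho_0$; (ii) $\Re\rho(\tau)=1/2$ if $\tau<\tau_0$;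 (iii) $\Re\rho(\tau)<1/2$ if $\tau>\tau_0$. 2) There are $\eta>0$ and a zero trajectory $\tilde\rho(\tau)$, $\tau\in(\tau_0-\eta,\tau_0+\eta)$, of $f'_s(s,\tau)=\frac{\partial}{\partial s}f(s,\tau)$ such that (a) $\tilde\rho(\tau_0)=\rho_0$; (b) $\Re\tilde\rho(\tau)>1/2$ if $\tau<\tau_0$; (c) $\Re\tilde\rho(\tau)<1/2$ if $\tau>\tau_0$. -/

import Mathlib

/-- The family `f(s, τ) = (1 - τ)(1 + √5 / 5^s) ζ(s) + τ L(s, ψ)` attached to a Dirichlet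
character `ψ` modulo `5`; here `ζ` and `L(·, ψ)` are the meromorphically continued functions.
The formula is used for every real `τ`. -/
noncomputable def zetaFamily (ψ : DirichletCharacter ℂ 5) (s : ℂ) (τ : ℝ) : ℂ :=
  (1 - (τ : ℂ)) * (1 + ((Real.sqrt 5 : ℝ) : ℂ) / (5 : ℂ) ^ s) * riemannZeta s +
    (τ : ℂ) * DirichletCharacter.LFunction ψ s

/-- The derivative `f'_s(s, τ)` of the family with respect to `s`. -/
noncomputable def zetaFamilyDeriv (ψ : DirichletCharacter ℂ 5) (s : ℂ) (τ : ℝ) : ℂ :=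
  deriv (fun z : ℂ => zetaFamily ψ z τ) s

/-- `ρ`, restricted to `(τ₀ - θ, τ₀ + θ)` with `θ > 0`, is a zero trajectory of `g(s, τ)`:
it is continuous there, and `ρ τ` is a zero of `g(·, τ)` for each `τ` of the interval.
Analyticity at the point only excludes the conventional value of `g(·, τ)` at a pole. -/
def IsZeroTrajectory (g : ℂ → ℝ → ℂ) (ρ : ℝ → ℂ) (τ₀ θ : ℝ) : Prop :=
  0 < θ ∧ ContinuousOn ρ (Set.Ioo (τ₀ - θ) (τ₀ + θ)) ∧
    ∀ τ ∈ Set.Ioo (τ₀ - θ) (τ₀ + θ),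
      AnalyticAt ℂ (fun s : ℂ => g s τ) (ρ τ) ∧ g (ρ τ) τ = 0

/-! Multiplying `f` by `E(s) = 5^(s/2) Γ_ℝ(s)` turns both summands into functions invariant under `s
↦ 1 - conj s` up to conjugation. In the coordinate `s = ρ₀ + i u` the critical line is the real
`u`-axis, `Re s < 1/2` means `Im u > 0`, and with `ε = τ - τ₀` the completed family is a pencil `P +
ε h` of functions real on the real axis. Here `P = u² p` with `p(0) ≠ 0`. Since `f' E = (f E)' -
(E'/E) f E`, zeros of `f'` are solutions of `P' + ε h' = i k (P + ε h)`, where `k = E'/E` along the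
line.

The only arithmetic input beyond the symmetry is `Re k(0) > 0` high on the critical line; it follows
from `Re digamma(1/4 + i y) → ∞` (`exists_forall_logDeriv_completingFactor_re_pos`).

The rest is local (`hasZeroGerm_iff_hasZeroGerm_critical`). If `h(0) ≠ 0`, zeros satisfy `u² ≈ -ε
h(0)/p(0)`, while the critical point is `u = ε R(u)` with `Im R(0) = Re k(0) h(0) / (2 p(0))`. Thus
both statements hold exactly when `h(0) p(0) > 0`. If `h(0) = 0`, then `P + ε h = u p (u + ε r)` has
only real zeros near `0`, and a Gauss-Lucas type sign argument excludes critical points in the upper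
half plane for `ε > 0`; both statements fail. -/

open Filter Topology ComplexConjugate

/-! ### Functions that are real on the real axis near `0`. -/

/-- Near `0` the function commutes with complex conjugation. -/
def IsConjSymmAtZero (f : ℂ → ℂ) : Prop :=
  ∀ᶠ u in 𝓝 (0 : ℂ), f (conj u) = conj (f u)

theorem tendsto_conj_zero : Tendsto (fun u : ℂ => conj u) (𝓝 0) (𝓝 0) := by
  have := Complex.continuous_conj.tendsto (0 : ℂ)
  rwa [map_zero] at this

namespace IsConjSymmAtZero

variable {f g : ℂ → ℂ}

theorem im_eq_zero (hf : IsConjSymmAtZero f) : (f 0).im = 0 := by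
  have h := hf.self_of_nhds
  rw [map_zero] at h
  exact Complex.conj_eq_iff_im.mp h.symm

theorem eq_ofReal (hf : IsConjSymmAtZero f) : f 0 = ((f 0).re : ℂ) :=
  Complex.ext (by simp) (by simp [hf.im_eq_zero])

theorem div (hf : IsConjSymmAtZero f) (hg : IsConjSymmAtZero g) :
    IsConjSymmAtZero (fun u => f u / g u) := by
  filter_upwards [hf, hg] with u h1 h2
  simp [h1, h2]

theorem deriv (hf : IsConjSymmAtZero f) : IsConjSymmAtZero (deriv f) := by
  have hc : ∀ᶠ u in 𝓝 (0 : ℂ), (fun z => conj (f (conj z))) =ᶠ[𝓝 u] f := by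
    filter_upwards [eventually_eventually_nhds.mpr hf] with u hu
    filter_upwards [hu] with z hz
    rw [hz, Complex.conj_conj]
  filter_upwards [tendsto_conj_zero.eventually hc] with u hu
  have h1 := hu.deriv_eq
  have h2 := congrFun (deriv_conj_conj (𝕜 := ℂ) (f := f)) (conj u)
  simp only [Function.comp_def, Complex.conj_conj] at h2
  rw [← h1, h2]

theorem of_pow_mul {n : ℕ} (hf : IsConjSymmAtZero f) (hg : ContinuousAt g 0)
    (hfg : ∀ᶠ u in 𝓝 (0 : ℂ), f u = u ^ n * g u) : IsConjSymmAtZero g := by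
  have h1 : ∀ᶠ u in 𝓝 (0 : ℂ), u ≠ 0 → g (conj u) = conj (g u) := by
    filter_upwards [hf, hfg, tendsto_conj_zero.eventually hfg] with u a b c hu
    rw [b, c, map_mul, map_pow] at a
    exact mul_left_cancel₀ (pow_ne_zero n (by simpa using hu)) a
  have h0 : g (conj 0) = conj (g 0) := by
    have hgc : Tendsto (fun u : ℂ => g (conj u)) (𝓝[≠] 0) (𝓝 (g 0)) :=
      (hg.tendsto.comp tendsto_conj_zero).mono_left nhdsWithin_le_nhds
    have hcg : Tendsto (fun u : ℂ => conj (g u)) (𝓝[≠] 0) (𝓝 (conj (g 0))) :=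
      ((Complex.continuous_conj.tendsto _).comp hg.tendsto).mono_left nhdsWithin_le_nhds
    rw [map_zero]
    refine tendsto_nhds_unique_of_eventuallyEq hgc hcg ?_
    exact eventually_nhdsWithin_iff.mpr h1
  filter_upwards [h1] with u hu
  by_cases h : u = 0
  · rw [h]; exact h0
  · exact hu h

/-- This is the Lipschitz bound for `f` at the pair `u`, `conj u`, whose values differ by `2 i Im
f(u)`. It is used to force `Im u = 0` in equations `u = w f(u)` with `w` real and small. -/
theorem exists_abs_im_le (hf : IsConjSymmAtZero f) (hfa : AnalyticAt ℂ f 0) :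
    ∃ C > 0, ∀ᶠ u in 𝓝 (0 : ℂ), |(f u).im| ≤ C * |u.im| := by
  have hO := hfa.hasStrictDerivAt.hasStrictFDerivAt.isBigO_sub
  have ht : Tendsto (fun u : ℂ => (u, conj u)) (𝓝 0) (𝓝 ((0 : ℂ), (0 : ℂ))) :=
    tendsto_id.prodMk_nhds tendsto_conj_zero
  obtain ⟨C, hC, hb⟩ := (hO.comp_tendsto ht).exists_pos
  refine ⟨C, hC, ?_⟩
  filter_upwards [hb.bound, hf] with u hu hs
  simp only [Function.comp_apply, hs, Complex.sub_conj, norm_mul, Complex.norm_I, mul_one,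
    Complex.norm_real, Real.norm_eq_abs] at hu
  rw [abs_of_pos (by norm_num : (0 : ℝ) < 2)] at hu
  linarith

end IsConjSymmAtZero

/-! ### Local solutions of equations with a parameter. -/

/-- Local solution `u = T w` of `u = w R(u)`, continuous in the parameter `w`. -/
theorem exists_continuous_solution_eq_mul {R : ℂ → ℂ} (hR : AnalyticAt ℂ R 0) (h0 : R 0 ≠ 0) :
    ∃ T : ℂ → ℂ, T 0 = 0 ∧ (∀ᶠ w in 𝓝 (0 : ℂ), ContinuousAt T w) ∧
      ∀ᶠ w in 𝓝 (0 : ℂ), T w = w * R (T w) := by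
  -- The equation reads `u / R u = w`, and the left side has derivative `1 / R 0 ≠ 0` at `0`, so `T`
  -- is its local inverse.
  set g : ℂ → ℂ := fun u => u / R u with hg
  have hga : AnalyticAt ℂ g 0 := analyticAt_id.div hR h0
  have hd : HasDerivAt g (1 / R 0) 0 := by
    have := (hasDerivAt_id (0 : ℂ)).div hR.differentiableAt.hasDerivAt h0
    refine this.congr_deriv ?_
    rw [id, one_mul, zero_mul, sub_zero]
    field_simp
  have hs : HasStrictDerivAt g (1 / R 0) 0 := hd.deriv ▸ hga.hasStrictDerivAt
  have hne : 1 / R 0 ≠ 0 := one_div_ne_zero h0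
  have hg0 : g 0 = 0 := by simp [hg]
  have hsF := hs.hasStrictFDerivAt_equiv hne
  have hright := hs.eventually_right_inverse hne
  have hleft := hs.eventually_left_inverse hne
  rw [hg0] at hright
  refine ⟨hs.localInverse g _ 0 hne, ?_, ?_, ?_⟩
  · have := hleft.self_of_nhds
    rwa [hg0] at this
  · have hm : g 0 ∈ (hsF.toOpenPartialHomeomorph g).target :=
      hsF.image_mem_toOpenPartialHomeomorph_target
    rw [hg0] at hm
    filter_upwards [(hsF.toOpenPartialHomeomorph g).open_target.mem_nhds hm] with w hw
    exact (hsF.toOpenPartialHomeomorph g).continuousAt_symm hw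
  · have hc : Tendsto (hs.localInverse g _ 0 hne) (𝓝 0) (𝓝 0) := by
      have := hsF.localInverse_tendsto
      rwa [hg0] at this
    filter_upwards [hright, hc.eventually (hR.continuousAt.eventually_ne h0)] with w hw hRw
    have : hs.localInverse g _ 0 hne w / R (hs.localInverse g _ 0 hne w) = w := hw
    exact (div_eq_iff hRw).mp this

/-- Near `0`, the equation `g(u, ε) = 0` has a continuous solution `u = u(ε)` with `u(0) = 0` whose
imaginary part satisfies `p` for `ε < 0` and `q` for `ε > 0`. -/
def HasZeroGerm (g : ℂ → ℝ → ℂ) (p q : ℝ → Prop) : Prop :=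
  ∃ u : ℝ → ℂ, u 0 = 0 ∧ (∀ᶠ ε in 𝓝 (0 : ℝ), ContinuousAt u ε) ∧
    (∀ᶠ ε in 𝓝 (0 : ℝ), g (u ε) ε = 0) ∧
    (∀ᶠ ε in 𝓝[<] (0 : ℝ), p (u ε).im) ∧ ∀ᶠ ε in 𝓝[>] (0 : ℝ), q (u ε).im

theorem tendsto_zero_of_germ {u : ℝ → ℂ} (h0 : u 0 = 0)
    (hc : ∀ᶠ ε in 𝓝 (0 : ℝ), ContinuousAt u ε) : Tendsto u (𝓝 0) (𝓝 0) := by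
  have := hc.self_of_nhds.tendsto
  rwa [h0] at this

theorem tendsto_ofReal_zero : Tendsto (fun ε : ℝ => (ε : ℂ)) (𝓝 0) (𝓝 0) := by
  have := Complex.continuous_ofReal.tendsto (0 : ℝ)
  rwa [Complex.ofReal_zero] at this

/-- A continuous square root of `-ε`. -/
noncomputable def sqrtNeg (ε : ℝ) : ℂ := (√(-ε) : ℝ) + (√ε : ℝ) * Complex.I

theorem continuous_sqrtNeg : Continuous sqrtNeg := by
  unfold sqrtNeg; fun_prop

theorem sqrtNeg_zero : sqrtNeg 0 = 0 := by simp [sqrtNeg]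

theorem sqrtNeg_of_nonpos {ε : ℝ} (h : ε ≤ 0) : sqrtNeg ε = (√(-ε) : ℝ) := by
  simp [sqrtNeg, Real.sqrt_eq_zero_of_nonpos h]

theorem sqrtNeg_of_nonneg {ε : ℝ} (h : 0 ≤ ε) : sqrtNeg ε = (√ε : ℝ) * Complex.I := by
  simp [sqrtNeg, Real.sqrt_eq_zero_of_nonpos (neg_nonpos.mpr h)]

theorem sqrtNeg_sq (ε : ℝ) : sqrtNeg ε ^ 2 = -(ε : ℂ) := by
  rcases le_total ε 0 with h | h
  · rw [sqrtNeg_of_nonpos h, ← Complex.ofReal_pow, Real.sq_sqrt (by linarith)]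
    simp
  · rw [sqrtNeg_of_nonneg h, mul_pow, ← Complex.ofReal_pow, Real.sq_sqrt h, Complex.I_sq]
    ring

theorem eventually_deriv_sq_mul {P p : ℂ → ℂ} (hp : AnalyticAt ℂ p 0)
    (hP : ∀ᶠ u in 𝓝 (0 : ℂ), P u = u ^ 2 * p u) :
    ∀ᶠ u in 𝓝 (0 : ℂ), deriv P u = 2 * u * p u + u ^ 2 * deriv p u := by
  filter_upwards [eventually_eventually_nhds.mpr hP, hp.eventually_analyticAt] with u hPu hpu
  rw [EventuallyEq.deriv_eq (f := fun u => u ^ 2 * p u) hPu]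
  have := ((hasDerivAt_pow 2 u).fun_mul hpu.differentiableAt.hasDerivAt).deriv
  simpa using this

/-! ### Bifurcation of a double zero in a real pencil. -/

section Germs

variable {P h k p : ℂ → ℂ}

/-- With `Q² = h/p` the equation becomes `u² = -ε Q(u)²`, and it suffices to solve `u = w Q(u)` with
`w² = -ε`. For `ε < 0` the parameter `w` is real, hence so is `u`; for `ε > 0` it is `i√ε`, and `Im
u = √ε Re Q(u) > 0`. -/
theorem hasZeroGerm_of_pos (hp : AnalyticAt ℂ p 0) (hh : AnalyticAt ℂ h 0)
    (hps : IsConjSymmAtZero p) (hhs : IsConjSymmAtZero h)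
    (hP : ∀ᶠ u in 𝓝 (0 : ℂ), P u = u ^ 2 * p u) (hpos : 0 < (h 0).re * (p 0).re) :
    HasZeroGerm (fun u ε => P u + (ε : ℂ) * h u) (· = 0) (0 < ·) := by
  have hh0 : h 0 ≠ 0 := fun e => by simp [e] at hpos
  have hp0 : p 0 ≠ 0 := fun e => by simp [e] at hpos
  set r : ℂ → ℂ := fun u => p u / h u with hr
  have hra : AnalyticAt ℂ r 0 := hp.div hh hh0
  have hrs : IsConjSymmAtZero r := hps.div hhs
  have hr0 : 0 < (r 0).re := by
    have : r 0 = (((p 0).re / (h 0).re : ℝ) : ℂ) := by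
      rw [Complex.ofReal_div, ← hps.eq_ofReal, ← hhs.eq_ofReal]
    rw [this, Complex.ofReal_re, ← mul_div_mul_left _ _ (left_ne_zero_of_mul hpos.ne')]
    exact div_pos hpos (mul_self_pos.mpr (left_ne_zero_of_mul hpos.ne'))
  have hslit : r 0 ∈ Complex.slitPlane := Or.inl hr0
  -- The principal logarithm is available because `r 0 > 0`; it keeps the symmetry under conjugation
  -- and makes `Q 0` positive.
  set Q : ℂ → ℂ := fun u => Complex.exp (-Complex.log (r u) / 2) with hQ
  have hQa : AnalyticAt ℂ Q 0 := ((hra.clog hslit).neg.div_const).cexp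
  have hrslit : ∀ᶠ u in 𝓝 (0 : ℂ), r u ∈ Complex.slitPlane :=
    hra.continuousAt.eventually (Complex.isOpen_slitPlane.mem_nhds hslit)
  have hQs : IsConjSymmAtZero Q := by
    filter_upwards [hrs, hrslit] with u hu hs
    simp only [hQ, hu, Complex.log_conj _ (Complex.mem_slitPlane_iff_arg.mp hs).1,
      ← Complex.exp_conj, map_div₀, map_neg, Complex.conj_ofNat]
  have hQ2 : ∀ᶠ u in 𝓝 (0 : ℂ), Q u ^ 2 * p u = h u := by
    filter_upwards [hrslit, hh.continuousAt.eventually_ne hh0] with u hs hhu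
    have hru : r u ≠ 0 := Complex.slitPlane_ne_zero hs
    have : Q u ^ 2 = (r u)⁻¹ := by
      simp only [hQ]
      rw [← Complex.exp_nat_mul, show ((2 : ℕ) : ℂ) * (-Complex.log (r u) / 2) = -Complex.log (r u)
        by push_cast; ring, Complex.exp_neg, Complex.exp_log hru]
    have hpr : p u = r u * h u := by simp only [hr]; field_simp
    rw [this, hpr, inv_mul_cancel_left₀ hru]
  have hQ0 : 0 < (Q 0).re := by
    have hrr : r 0 = ((r 0).re : ℂ) := hrs.eq_ofReal
    have : Q 0 = (Real.exp (-Real.log (r 0).re / 2) : ℝ) := by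
      simp only [hQ]
      rw [hrr, ← Complex.ofReal_log hr0.le]
      push_cast
      simp
    rw [this, Complex.ofReal_re]
    exact Real.exp_pos _
  obtain ⟨T, hT0, hTc, hT⟩ := exists_continuous_solution_eq_mul hQa (Complex.exp_ne_zero _)
  have hw : Tendsto sqrtNeg (𝓝 0) (𝓝 0) := by
    have := continuous_sqrtNeg.tendsto 0
    rwa [sqrtNeg_zero] at this
  have hu0 : T (sqrtNeg 0) = 0 := by rw [sqrtNeg_zero, hT0]
  have huc : ∀ᶠ ε in 𝓝 (0 : ℝ), ContinuousAt (fun ε => T (sqrtNeg ε)) ε := by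
    filter_upwards [hw.eventually hTc] with ε hε
    exact ContinuousAt.comp (f := sqrtNeg) hε continuous_sqrtNeg.continuousAt
  have hut := tendsto_zero_of_germ (u := fun ε => T (sqrtNeg ε)) hu0 huc
  refine ⟨fun ε => T (sqrtNeg ε), hu0, huc, ?_, ?_, ?_⟩
  · filter_upwards [hw.eventually hT, hut.eventually hP, hut.eventually hQ2] with ε h1 h2 h3
    have h4 : T (sqrtNeg ε) ^ 2 = sqrtNeg ε ^ 2 * Q (T (sqrtNeg ε)) ^ 2 := by
      conv_lhs => rw [h1]
      ring
    rw [h2, h4, sqrtNeg_sq, mul_assoc, h3]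
    ring
  · obtain ⟨C, hC, hCb⟩ := hQs.exists_abs_im_le hQa
    have hsmall : ∀ᶠ ε in 𝓝 (0 : ℝ), √(-ε) * C < 1 := by
      have : ContinuousAt (fun ε : ℝ => √(-ε) * C) 0 := by fun_prop
      exact this.eventually_lt_const (by simp)
    have hlt : ∀ᶠ ε in 𝓝[<] (0 : ℝ), ε < 0 := self_mem_nhdsWithin
    filter_upwards [hlt, nhdsWithin_le_nhds hsmall, nhdsWithin_le_nhds (hw.eventually hT),
      nhdsWithin_le_nhds (hut.eventually hCb)] with ε hε h1 h2 h3
    have h4 : (T (sqrtNeg ε)).im = √(-ε) * (Q (T (sqrtNeg ε))).im := by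
      conv_lhs => rw [h2]
      conv_lhs => rw [sqrtNeg_of_nonpos hε.le]
      rw [Complex.im_ofReal_mul, sqrtNeg_of_nonpos hε.le]
    -- Here `|Im u| ≤ √(-ε) C |Im u|` with `√(-ε) C < 1`, which is impossible unless `Im u = 0`.
    by_contra hne
    have h5 : |(T (sqrtNeg ε)).im| ≤ √(-ε) * (C * |(T (sqrtNeg ε)).im|) := by
      conv_lhs => rw [h4]
      rw [abs_mul, abs_of_nonneg (Real.sqrt_nonneg _)]
      gcongr
    have h6 := abs_pos.mpr hne
    nlinarith
  · have hlt : ∀ᶠ ε in 𝓝[>] (0 : ℝ), 0 < ε := self_mem_nhdsWithin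
    have hre : ∀ᶠ u in 𝓝 (0 : ℂ), 0 < (Q u).re :=
      (Complex.continuous_re.continuousAt.comp hQa.continuousAt).eventually_const_lt hQ0
    filter_upwards [hlt, nhdsWithin_le_nhds (hw.eventually hT),
      nhdsWithin_le_nhds (hut.eventually hre)] with ε hε h2 h3
    have h4 : (T (sqrtNeg ε)).im = √ε * (Q (T (sqrtNeg ε))).re := by
      conv_lhs => rw [h2]
      conv_lhs => rw [sqrtNeg_of_nonneg hε.le]
      rw [mul_assoc, Complex.im_ofReal_mul, Complex.I_mul_im, sqrtNeg_of_nonneg hε.le]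
    rw [h4]
    exact mul_pos (Real.sqrt_pos.mpr hε) h3

/-- For `ε < 0` a real zero would give `u² Re (p/h) = -ε > 0`, although `Re (p/h) < 0` near `0`. -/
theorem not_hasZeroGerm_of_neg (hp : AnalyticAt ℂ p 0) (hh : AnalyticAt ℂ h 0)
    (hps : IsConjSymmAtZero p) (hhs : IsConjSymmAtZero h)
    (hP : ∀ᶠ u in 𝓝 (0 : ℂ), P u = u ^ 2 * p u) (hneg : (h 0).re * (p 0).re < 0) :
    ¬ HasZeroGerm (fun u ε => P u + (ε : ℂ) * h u) (· = 0) (0 < ·) := by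
  rintro ⟨u, hu0, huc, hu, hneg', -⟩
  have hut := tendsto_zero_of_germ hu0 huc
  have hh0 : h 0 ≠ 0 := fun e => by simp [e] at hneg
  have hr0 : (p 0 / h 0).re < 0 := by
    have : p 0 / h 0 = (((p 0).re / (h 0).re : ℝ) : ℂ) := by
      rw [Complex.ofReal_div, ← hps.eq_ofReal, ← hhs.eq_ofReal]
    rw [this, Complex.ofReal_re, ← mul_div_mul_left _ _ (left_ne_zero_of_mul hneg.ne)]
    exact div_neg_of_neg_of_pos hneg (mul_self_pos.mpr (left_ne_zero_of_mul hneg.ne))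
  have hre : ∀ᶠ u in 𝓝 (0 : ℂ), (p u / h u).re < 0 :=
    (Complex.continuous_re.continuousAt.comp
      (hp.div hh hh0).continuousAt).eventually_lt_const hr0
  have hlt : ∀ᶠ ε in 𝓝[<] (0 : ℝ), ε < 0 := self_mem_nhdsWithin
  have hall := hu.and ((hut.eventually hP).and ((hut.eventually hre).and
    (hut.eventually (hh.continuousAt.eventually_ne hh0))))
  obtain ⟨ε, hε, h1, h2, h3, h4, h5⟩ :=
    (hlt.and (hneg'.and (hall.filter_mono nhdsWithin_le_nhds))).exists
  have h6 : u ε = ((u ε).re : ℂ) := Complex.ext (by simp) (by simpa using h1)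
  have h7 : (((u ε).re ^ 2 : ℝ) : ℂ) * (p (u ε) / h (u ε)) = ((-ε : ℝ) : ℂ) := by
    rw [Complex.ofReal_pow, ← h6, ← mul_div_assoc, ← h3, div_eq_iff h5]
    push_cast
    linear_combination h2
  have h8 := congrArg Complex.re h7
  rw [Complex.re_ofReal_mul, Complex.ofReal_re] at h8
  nlinarith [sq_nonneg (u ε).re]

/-- Near the double zero, the equation for the critical point becomes `u = ε R(u)`. -/
theorem eventually_critical_iff (hp : AnalyticAt ℂ p 0) (hk : AnalyticAt ℂ k 0)
    (hp0 : p 0 ≠ 0)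
    (hP : ∀ᶠ u in 𝓝 (0 : ℂ), P u = u ^ 2 * p u) :
    ∀ᶠ u in 𝓝 (0 : ℂ), ∀ ε : ℝ,
      deriv P u + (ε : ℂ) * deriv h u - Complex.I * k u * (P u + (ε : ℂ) * h u) = 0 ↔
      u = ε * (-(deriv h u - Complex.I * k u * h u) /
        (2 * p u + u * deriv p u - Complex.I * k u * u * p u)) := by
  have hN : AnalyticAt ℂ (fun u => 2 * p u + u * deriv p u - Complex.I * k u * u * p u) 0 :=
    ((analyticAt_const.mul hp).add (analyticAt_id.mul hp.deriv)).sub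
      (((analyticAt_const.mul hk).mul analyticAt_id).mul hp)
  have hN0 := hN.continuousAt.eventually_ne
    (show (2 * p 0 + 0 * deriv p 0 - Complex.I * k 0 * 0 * p 0) ≠ 0 by simpa using hp0)
  filter_upwards [hN0, hP, eventually_deriv_sq_mul hp hP] with u hu hPu hd
  intro ε
  rw [hd, hPu, ← mul_div_assoc, eq_div_iff hu]
  constructor <;> intro H <;> linear_combination H

/-- As `p`, `h` and `h'` are real at `0`, only the term with `k` contributes. This is where the sign
of `Re k(0)` links the motion of the critical point to the splitting of the zeros. -/
theorem im_quotient_at_zero (hps : IsConjSymmAtZero p) (hhs : IsConjSymmAtZero h) :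
    (-(deriv h 0 - Complex.I * k 0 * h 0) /
        (2 * p 0 + 0 * deriv p 0 - Complex.I * k 0 * 0 * p 0)).im =
      (k 0).re * (h 0).re / (2 * (p 0).re) := by
  have e : 2 * p 0 + 0 * deriv p 0 - Complex.I * k 0 * 0 * p 0 = ((2 * (p 0).re : ℝ) : ℂ) := by
    rw [Complex.ofReal_mul, ← hps.eq_ofReal]; push_cast; ring
  rw [e, Complex.div_ofReal_im]
  congr 1
  simp [hhs.deriv.im_eq_zero, hhs.im_eq_zero]

theorem analyticAt_quotient (hp : AnalyticAt ℂ p 0) (hh : AnalyticAt ℂ h 0)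
    (hk : AnalyticAt ℂ k 0) (hp0 : p 0 ≠ 0) :
    AnalyticAt ℂ (fun u => -(deriv h u - Complex.I * k u * h u) /
        (2 * p u + u * deriv p u - Complex.I * k u * u * p u)) 0 :=
  (hh.deriv.sub ((analyticAt_const.mul hk).mul hh)).neg.div
    (((analyticAt_const.mul hp).add (analyticAt_id.mul hp.deriv)).sub
      (((analyticAt_const.mul hk).mul analyticAt_id).mul hp)) (by simpa using hp0)

theorem hasZeroGerm_critical_of_pos (hp : AnalyticAt ℂ p 0) (hh : AnalyticAt ℂ h 0)
    (hk : AnalyticAt ℂ k 0) (hps : IsConjSymmAtZero p) (hhs : IsConjSymmAtZero h)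
    (hk0 : 0 < (k 0).re)
    (hP : ∀ᶠ u in 𝓝 (0 : ℂ), P u = u ^ 2 * p u) (hpos : 0 < (h 0).re * (p 0).re) :
    HasZeroGerm (fun u ε => deriv P u + (ε : ℂ) * deriv h u -
      Complex.I * k u * (P u + (ε : ℂ) * h u)) (· < 0) (0 < ·) := by
  have hp0 : p 0 ≠ 0 := fun e => by simp [e] at hpos
  have hRa := analyticAt_quotient hp hh hk hp0
  have hR0 := im_quotient_at_zero (k := k) hps hhs
  have hiff := eventually_critical_iff (h := h) hp hk hp0 hP
  set R : ℂ → ℂ := fun u => -(deriv h u - Complex.I * k u * h u) /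
        (2 * p u + u * deriv p u - Complex.I * k u * u * p u) with hR
  have hRpos : 0 < (R 0).im := by
    simp only [hR]
    rw [hR0, ← mul_div_mul_right _ _ (right_ne_zero_of_mul hpos.ne')]
    have := right_ne_zero_of_mul hpos.ne'
    refine div_pos ?_ ?_
    · rw [mul_assoc]; exact mul_pos hk0 hpos
    · rw [mul_assoc]; exact mul_pos two_pos (mul_self_pos.mpr this)
  obtain ⟨T, hT0, hTc, hT⟩ := exists_continuous_solution_eq_mul hRa
    (fun e => by simp [e] at hRpos)
  have hu0 : (fun ε : ℝ => T ε) 0 = 0 := by simpa using hT0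
  have huc : ∀ᶠ ε in 𝓝 (0 : ℝ), ContinuousAt (fun ε : ℝ => T ε) ε := by
    filter_upwards [tendsto_ofReal_zero.eventually hTc] with ε hε
    exact ContinuousAt.comp (f := fun ε : ℝ => (ε : ℂ)) hε Complex.continuous_ofReal.continuousAt
  have hut := tendsto_zero_of_germ (u := fun ε : ℝ => T ε) hu0 huc
  have hre : ∀ᶠ u in 𝓝 (0 : ℂ), 0 < (R u).im :=
    (Complex.continuous_im.continuousAt.comp hRa.continuousAt).eventually_const_lt hRpos
  have him : ∀ᶠ ε : ℝ in 𝓝 (0 : ℝ), (T ε).im = ε * (R (T ε)).im := by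
    filter_upwards [tendsto_ofReal_zero.eventually hT] with ε h2
    rw [← Complex.im_ofReal_mul]
    exact congrArg Complex.im h2
  refine ⟨fun ε : ℝ => T ε, hu0, huc, ?_, ?_, ?_⟩
  · filter_upwards [tendsto_ofReal_zero.eventually hT, hut.eventually hiff] with ε h1 h2
    exact (h2 ε).mpr h1
  · have hlt : ∀ᶠ ε in 𝓝[<] (0 : ℝ), ε < 0 := self_mem_nhdsWithin
    filter_upwards [hlt, nhdsWithin_le_nhds him, nhdsWithin_le_nhds (hut.eventually hre)]
      with ε hε h1 h2
    rw [h1]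
    exact mul_neg_of_neg_of_pos hε h2
  · have hlt : ∀ᶠ ε in 𝓝[>] (0 : ℝ), 0 < ε := self_mem_nhdsWithin
    filter_upwards [hlt, nhdsWithin_le_nhds him, nhdsWithin_le_nhds (hut.eventually hre)]
      with ε hε h1 h2
    rw [h1]
    exact mul_pos hε h2

/-- Every germ of critical points satisfies `u = ε R(u)`, now with `Im R(0) < 0`, so it lies below
the real line for `ε > 0`. -/
theorem not_hasZeroGerm_critical_of_neg (hp : AnalyticAt ℂ p 0) (hh : AnalyticAt ℂ h 0)
    (hk : AnalyticAt ℂ k 0) (hps : IsConjSymmAtZero p) (hhs : IsConjSymmAtZero h)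
    (hk0 : 0 < (k 0).re)
    (hP : ∀ᶠ u in 𝓝 (0 : ℂ), P u = u ^ 2 * p u) (hneg : (h 0).re * (p 0).re < 0) :
    ¬ HasZeroGerm (fun u ε => deriv P u + (ε : ℂ) * deriv h u -
      Complex.I * k u * (P u + (ε : ℂ) * h u)) (· < 0) (0 < ·) := by
  rintro ⟨u, hu0, huc, hu, -, hpos⟩
  have hut := tendsto_zero_of_germ hu0 huc
  have hp0 : p 0 ≠ 0 := fun e => by simp [e] at hneg
  have hRa := analyticAt_quotient hp hh hk hp0
  have hR0 := im_quotient_at_zero (k := k) hps hhs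
  have hiff := eventually_critical_iff (h := h) hp hk hp0 hP
  set R : ℂ → ℂ := fun u => -(deriv h u - Complex.I * k u * h u) /
        (2 * p u + u * deriv p u - Complex.I * k u * u * p u) with hR
  have hRneg : (R 0).im < 0 := by
    simp only [hR]
    rw [hR0, ← mul_div_mul_right _ _ (right_ne_zero_of_mul hneg.ne)]
    have := right_ne_zero_of_mul hneg.ne
    refine div_neg_of_neg_of_pos ?_ ?_
    · rw [mul_assoc]; exact mul_neg_of_pos_of_neg hk0 hneg
    · rw [mul_assoc]; exact mul_pos two_pos (mul_self_pos.mpr this)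
  have hre : ∀ᶠ u in 𝓝 (0 : ℂ), (R u).im < 0 :=
    (Complex.continuous_im.continuousAt.comp hRa.continuousAt).eventually_lt_const hRneg
  have hlt : ∀ᶠ ε in 𝓝[>] (0 : ℝ), 0 < ε := self_mem_nhdsWithin
  have hall := hu.and ((hut.eventually hiff).and (hut.eventually hre))
  obtain ⟨ε, hε, h1, h2, h3, h4⟩ :=
    (hlt.and (hpos.and (hall.filter_mono nhdsWithin_le_nhds))).exists
  have h5 := congrArg Complex.im ((h3 ε).mp h2)
  rw [Complex.im_ofReal_mul] at h5
  have h6 : ε * (R (u ε)).im < 0 := mul_neg_of_pos_of_neg hε h4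
  exact absurd h1 (not_lt.mpr (h5.trans_lt h6).le)

/-- The pencil factors as `u p (u + ε r)`. A nonreal zero would satisfy `u = -ε r(u)`, contradicting
`|Im r(u)| ≤ C |Im u|` once `ε C < 1`. -/
theorem not_hasZeroGerm_of_common_zero {r : ℂ → ℂ} (hp : AnalyticAt ℂ p 0) (hr : AnalyticAt ℂ r 0)
    (hrs : IsConjSymmAtZero r) (hp0 : p 0 ≠ 0)
    (hP : ∀ᶠ u in 𝓝 (0 : ℂ), P u = u ^ 2 * p u)
    (hh : ∀ᶠ u in 𝓝 (0 : ℂ), h u = u * r u * p u) :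
    ¬ HasZeroGerm (fun u ε => P u + (ε : ℂ) * h u) (· = 0) (0 < ·) := by
  rintro ⟨u, hu0, huc, hu, -, hpos⟩
  have hut := tendsto_zero_of_germ hu0 huc
  obtain ⟨C, hC, hCb⟩ := hrs.exists_abs_im_le hr
  have hlt : ∀ᶠ ε in 𝓝[>] (0 : ℝ), 0 < ε := self_mem_nhdsWithin
  have hsmall : ∀ᶠ ε in 𝓝 (0 : ℝ), ε * C < 1 := by
    have : ContinuousAt (fun ε : ℝ => ε * C) 0 := by fun_prop
    exact this.eventually_lt_const (by simp)
  have hall := hu.and (hsmall.and ((hut.eventually hP).and ((hut.eventually hh).and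
    ((hut.eventually hCb).and (hut.eventually (hp.continuousAt.eventually_ne hp0))))))
  obtain ⟨ε, hε, him, h1, h2, h3, h4, h5, h6⟩ :=
    (hlt.and (hpos.and (hall.filter_mono nhdsWithin_le_nhds))).exists
  simp only at h1 him
  have hune : u ε ≠ 0 := fun e => by simp [e] at him
  have h7 : u ε = ((-ε : ℝ) : ℂ) * r (u ε) := by
    have : u ε * p (u ε) * (u ε + ε * r (u ε)) = 0 := by
      rw [h3, h4] at h1; linear_combination h1
    have := (mul_eq_zero.mp this).resolve_left (mul_ne_zero hune h6)
    push_cast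
    linear_combination this
  have h8 := congrArg Complex.im h7
  rw [Complex.im_ofReal_mul] at h8
  have h9 := neg_abs_le (r (u ε)).im
  rw [abs_of_pos him] at h5
  nlinarith

/-- A quantitative form of the fact that the logarithmic derivative of a polynomial with real zeros
has negative imaginary part in the upper half plane. -/
theorem im_inv_add_div_neg {u w e : ℂ} (hu : 0 < u.im) (hw : u.im / 2 ≤ w.im) (hwn : ‖w‖ ≤ 1)
    (he : ‖e‖ ≤ 1 / 2) (hei : |e.im| ≤ u.im / 4) : (1 / u + (1 + e) / w).im < 0 := by
  have hu0 : u ≠ 0 := fun h => by simp [h] at hu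
  have hw0 : w ≠ 0 := fun h => by simp [h] at hw; linarith
  rw [Complex.add_im, one_div, Complex.inv_im]
  have h1 : -u.im / Complex.normSq u < 0 :=
    div_neg_of_neg_of_pos (by linarith) (Complex.normSq_pos.mpr hu0)
  -- The constants balance: `Im e · Re w ≤ Im u / 4`, while `(1 + Re e) Im w ≥ (1/2)(Im u / 2)`.
  -- Strictness comes from `1 / u` alone.
  have h2 : ((1 + e) / w).im ≤ 0 := by
    rw [Complex.div_im, ← sub_div]
    refine div_nonpos_of_nonpos_of_nonneg ?_ (Complex.normSq_nonneg w)
    simp only [Complex.add_re, Complex.add_im, Complex.one_re, Complex.one_im, zero_add]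
    have h3 : |e.re| ≤ 1 / 2 := (Complex.abs_re_le_norm e).trans he
    have h4 : |w.re| ≤ 1 := (Complex.abs_re_le_norm w).trans hwn
    have h5 : e.im * w.re ≤ u.im / 4 := by
      calc e.im * w.re ≤ |e.im * w.re| := le_abs_self _
        _ = |e.im| * |w.re| := abs_mul _ _
        _ ≤ |e.im| * 1 := by gcongr
        _ ≤ u.im / 4 := by simpa using hei
    have h6 := (abs_le.mp h3).1
    nlinarith
  linarith

/-- Dividing the critical equation by `u p (u + ε r)` gives `1/u + (1 + ε r')/(u + ε r) = i k -
p'/p`. For small `ε > 0` and `Im u > 0` the left side has negative imaginary part, while that of the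
right side is close to `Re k(0) > 0`. -/
theorem not_hasZeroGerm_critical_of_common_zero {r : ℂ → ℂ} (hp : AnalyticAt ℂ p 0)
    (hr : AnalyticAt ℂ r 0) (hk : AnalyticAt ℂ k 0)
    (hps : IsConjSymmAtZero p) (hrs : IsConjSymmAtZero r) (hp0 : p 0 ≠ 0) (hk0 : 0 < (k 0).re)
    (hP : ∀ᶠ u in 𝓝 (0 : ℂ), P u = u ^ 2 * p u)
    (hh : ∀ᶠ u in 𝓝 (0 : ℂ), h u = u * r u * p u) :
    ¬ HasZeroGerm (fun u ε => deriv P u + (ε : ℂ) * deriv h u -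
      Complex.I * k u * (P u + (ε : ℂ) * h u)) (· < 0) (0 < ·) := by
  rintro ⟨u, hu0, huc, hu, -, hpos⟩
  have hut := tendsto_zero_of_germ hu0 huc
  have hdP := eventually_deriv_sq_mul hp hP
  have hdh : ∀ᶠ u in 𝓝 (0 : ℂ), deriv h u =
      (r u + u * deriv r u) * p u + u * r u * deriv p u := by
    filter_upwards [eventually_eventually_nhds.mpr hh, hp.eventually_analyticAt,
      hr.eventually_analyticAt] with u hhu hpu hru
    rw [EventuallyEq.deriv_eq (f := fun u => u * r u * p u) hhu]
    have := (((hasDerivAt_id' u).fun_mul hru.differentiableAt.hasDerivAt).fun_mul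
      hpu.differentiableAt.hasDerivAt).deriv
    simpa using this
  obtain ⟨C, hC, hCb⟩ := hrs.exists_abs_im_le hr
  obtain ⟨D, hD, hDb⟩ := hrs.deriv.exists_abs_im_le hr.deriv
  have hm : ContinuousAt (fun u => (Complex.I * k u - deriv p u / p u).im) 0 :=
    Complex.continuous_im.continuousAt.comp
      ((continuousAt_const.mul hk.continuousAt).sub (hp.deriv.div hp hp0).continuousAt)
  have hm0 : 0 < (Complex.I * k 0 - deriv p 0 / p 0).im := by
    rw [Complex.sub_im, Complex.I_mul_im, (hps.deriv.div hps).im_eq_zero, sub_zero]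
    exact hk0
  have hmev := hut.eventually (hm.eventually_const_lt hm0)
  have hlt : ∀ᶠ ε in 𝓝[>] (0 : ℝ), 0 < ε := self_mem_nhdsWithin
  have hsmall : ∀ᶠ ε in 𝓝 (0 : ℝ), ε * C < 1 / 2 ∧ ε * D < 1 / 4 := by
    have h1 : ContinuousAt (fun ε : ℝ => ε * C) 0 := by fun_prop
    have h2 : ContinuousAt (fun ε : ℝ => ε * D) 0 := by fun_prop
    exact (h1.eventually_lt_const (by simp)).and (h2.eventually_lt_const (by simp))
  have hw : ∀ᶠ ε : ℝ in 𝓝 (0 : ℝ), ‖u ε + ε * r (u ε)‖ < 1 := by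
    have ht : Tendsto (fun ε : ℝ => u ε + ε * r (u ε)) (𝓝 0) (𝓝 (0 + 0 * r 0)) :=
      hut.add (tendsto_ofReal_zero.mul (hr.continuousAt.tendsto.comp hut))
    exact ht.norm.eventually_lt_const (by simp)
  have he : ∀ᶠ ε : ℝ in 𝓝 (0 : ℝ), ‖(ε : ℂ) * deriv r (u ε)‖ < 1 / 2 := by
    have ht : Tendsto (fun ε : ℝ => (ε : ℂ) * deriv r (u ε)) (𝓝 0) (𝓝 (0 * deriv r 0)) :=
      tendsto_ofReal_zero.mul (hr.deriv.continuousAt.tendsto.comp hut)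
    exact ht.norm.eventually_lt_const (by rw [zero_mul, norm_zero]; norm_num)
  have hall := (hu.and (hsmall.and ((hut.eventually hP).and ((hut.eventually hh).and
    ((hut.eventually hCb).and (hut.eventually (hp.continuousAt.eventually_ne hp0))))))).and
    ((hut.eventually hDb).and ((hut.eventually hdP).and ((hut.eventually hdh).and
      (hmev.and (hw.and he)))))
  obtain ⟨ε, hε, him, ⟨h1, ⟨h2, h2'⟩, h3, h4, h5, h6⟩, h7, h8, h9, h10, h11, h12⟩ :=
    (hlt.and (hpos.and (hall.filter_mono nhdsWithin_le_nhds))).exists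
  set z := u ε with hz
  rw [abs_of_pos him] at h5 h7
  have hwim : z.im / 2 ≤ (z + ε * r z).im := by
    rw [Complex.add_im, Complex.im_ofReal_mul]
    have := (abs_le.mp h5).1
    nlinarith
  have heim : |((ε : ℂ) * deriv r z).im| ≤ z.im / 4 := by
    rw [Complex.im_ofReal_mul, abs_mul, abs_of_pos hε]
    nlinarith
  have hkey := im_inv_add_div_neg him hwim h11.le h12.le heim
  have hz0 : z ≠ 0 := fun e => by simp [e] at him
  have hw0 : z + ε * r z ≠ 0 := fun e => by rw [e] at hwim; simp at hwim; linarith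
  have heq : 1 / z + (1 + (ε : ℂ) * deriv r z) / (z + ε * r z) =
      Complex.I * k z - deriv p z / p z := by
    simp only at h1
    rw [h3, h4, h8, h9] at h1
    field_simp
    linear_combination h1
  rw [heq] at hkey
  exact absurd hkey (not_lt.mpr h10.le)

/-- A double zero at `0` of the pencil `P + ε h`, commuting with conjugation, splits from real zeros
into nonreal ones as `ε` grows if and only if the solution of
`P' + ε h' = i k (P + ε h)`, `Re k > 0`, crosses the real line upwards. -/
theorem hasZeroGerm_iff_hasZeroGerm_critical (hPa : AnalyticAt ℂ P 0) (hh : AnalyticAt ℂ h 0)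
    (hk : AnalyticAt ℂ k 0) (hPs : IsConjSymmAtZero P) (hhs : IsConjSymmAtZero h)
    (hord : analyticOrderAt P 0 = 2) (hk0 : 0 < (k 0).re) :
    HasZeroGerm (fun u ε => P u + (ε : ℂ) * h u) (· = 0) (0 < ·) ↔
    HasZeroGerm (fun u ε => deriv P u + (ε : ℂ) * deriv h u -
      Complex.I * k u * (P u + (ε : ℂ) * h u)) (· < 0) (0 < ·) := by
  obtain ⟨p, hp, hp0, hP⟩ := (hPa.analyticOrderAt_eq_natCast (n := 2)).mp (by exact_mod_cast hord)
  simp only [sub_zero, smul_eq_mul] at hP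
  have hps : IsConjSymmAtZero p := hPs.of_pow_mul hp.continuousAt hP
  -- Vanishing of `h` at `0` means that this point stays a zero for every `ε`; then both sides are
  -- false. Otherwise the sign of `h(0) p(0)` decides.
  by_cases h0 : h 0 = 0
  · obtain ⟨q, hq, hhq⟩ : ∃ q : ℂ → ℂ, AnalyticAt ℂ q 0 ∧ ∀ᶠ u in 𝓝 (0 : ℂ), h u = u ^ 1 * q u := by
      have : ((1 : ℕ) : ℕ∞) ≤ analyticOrderAt h 0 := by
        rw [Nat.cast_one, Order.one_le_iff_ne_zero]
        exact hh.analyticOrderAt_ne_zero.mpr h0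
      obtain ⟨q, hq, hq'⟩ := (natCast_le_analyticOrderAt hh).mp this
      exact ⟨q, hq, by simpa using hq'⟩
    have hqs : IsConjSymmAtZero q := hhs.of_pow_mul hq.continuousAt hhq
    have hhr : ∀ᶠ u in 𝓝 (0 : ℂ), h u = u * (q u / p u) * p u := by
      filter_upwards [hhq, hp.continuousAt.eventually_ne hp0] with u hu hpu
      rw [hu]; field_simp
    exact iff_of_false
      (not_hasZeroGerm_of_common_zero hp (hq.div hp hp0) (hqs.div hps) hp0 hP hhr)
      (not_hasZeroGerm_critical_of_common_zero hp (hq.div hp hp0) hk hps (hqs.div hps) hp0 hk0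
        hP hhr)
  · have hne : (h 0).re * (p 0).re ≠ 0 := by
      refine mul_ne_zero (fun e => h0 ?_) (fun e => hp0 ?_)
      · rw [hhs.eq_ofReal, e, Complex.ofReal_zero]
      · rw [hps.eq_ofReal, e, Complex.ofReal_zero]
    rcases hne.lt_or_gt with hlt | hgt
    · exact iff_of_false (not_hasZeroGerm_of_neg hp hh hps hhs hP hlt)
        (not_hasZeroGerm_critical_of_neg hp hh hk hps hhs hk0 hP hlt)
    · exact iff_of_true (hasZeroGerm_of_pos hp hh hps hhs hP hgt)
        (hasZeroGerm_critical_of_pos hp hh hk hps hhs hk0 hP hgt)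

end Germs

/-! ### Growth of the real part of digamma on vertical lines. -/

theorem norm_GammaSeq {s : ℂ} {n : ℕ} (hn : 0 < n) :
    ‖Complex.GammaSeq s n‖ = (n : ℝ) ^ s.re * (n.factorial : ℝ) /
      ∏ j ∈ Finset.range (n + 1), ‖s + j‖ := by
  rw [Complex.GammaSeq, norm_div, norm_mul, norm_prod, Complex.norm_natCast_cpow_of_pos hn,
    Complex.norm_natCast]

theorem norm_add_I_div_le {y : ℝ} {a b : ℝ} (ha : 0 < a) (hab : a ≤ b) :
    ‖(a : ℂ)‖ / ‖(a : ℂ) + y * Complex.I‖ ≤ ‖(b : ℂ)‖ / ‖(b : ℂ) + y * Complex.I‖ := by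
  have hb : 0 < b := ha.trans_le hab
  have hpos : ∀ c : ℝ, 0 < c → 0 < ‖(c : ℂ) + y * Complex.I‖ := fun c hc => by
    rw [norm_pos_iff]
    intro h
    have := congrArg Complex.re h
    simp at this
    exact hc.ne' this
  rw [div_le_div_iff₀ (hpos a ha) (hpos b hb), Complex.norm_add_mul_I, Complex.norm_add_mul_I,
    Complex.norm_of_nonneg ha.le, Complex.norm_of_nonneg hb.le]
  refine le_of_sq_le_sq ?_ (by positivity)
  rw [mul_pow, mul_pow, Real.sq_sqrt (by positivity), Real.sq_sqrt (by positivity)]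
  have h1 : a ^ 2 ≤ b ^ 2 := by gcongr
  nlinarith [mul_le_mul_of_nonneg_right h1 (sq_nonneg y)]

/-- For fixed `y`, the quotient `|Γ(σ + iy)| / Γ(σ)` is nondecreasing in `σ > 0`. -/
theorem norm_Gamma_div_le (y : ℝ) {a b : ℝ} (ha : 0 < a) (hab : a ≤ b) :
    ‖Complex.Gamma (a + y * Complex.I)‖ / ‖Complex.Gamma a‖ ≤
      ‖Complex.Gamma (b + y * Complex.I)‖ / ‖Complex.Gamma b‖ := by
  have hb : 0 < b := ha.trans_le hab
  have hne : ∀ c : ℝ, 0 < c → Complex.Gamma c ≠ 0 := fun c hc =>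
    Complex.Gamma_ne_zero_of_re_pos (by simpa using hc)
  have ht : ∀ c : ℝ, 0 < c → Tendsto (fun n => ‖Complex.GammaSeq (c + y * Complex.I) n‖ /
      ‖Complex.GammaSeq c n‖) atTop
      (𝓝 (‖Complex.Gamma (c + y * Complex.I)‖ / ‖Complex.Gamma c‖)) := fun c hc =>
    (Complex.GammaSeq_tendsto_Gamma _).norm.div (Complex.GammaSeq_tendsto_Gamma _).norm
      (norm_ne_zero_iff.mpr (hne c hc))
  -- In Euler's limit the factor `n^c n!` cancels from the quotient, leaving a product of terms each
  -- monotone in `c`.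
  have hq : ∀ c : ℝ, 0 < c → ∀ n : ℕ, 0 < n → ‖Complex.GammaSeq (c + y * Complex.I) n‖ /
      ‖Complex.GammaSeq c n‖ =
      ∏ j ∈ Finset.range (n + 1), ‖((c + j : ℝ) : ℂ)‖ / ‖((c + j : ℝ) : ℂ) + y * Complex.I‖ := by
    intro c hc n hn
    rw [norm_GammaSeq hn, norm_GammaSeq hn, Finset.prod_div_distrib]
    have h1 : ∀ j : ℕ, (c : ℂ) + y * Complex.I + j = ((c + j : ℝ) : ℂ) + y * Complex.I := by
      intro j; push_cast; ring
    have h2 : ∀ j : ℕ, (c : ℂ) + j = ((c + j : ℝ) : ℂ) := by intro j; push_cast; ring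
    have h3 : ((c : ℂ) + y * Complex.I).re = (c : ℂ).re := by simp
    simp only [h1, h2, h3]
    have h4 : (n : ℝ) ^ (c : ℂ).re * (n.factorial : ℝ) ≠ 0 := by positivity
    have h5 : ∏ j ∈ Finset.range (n + 1), ‖((c + j : ℝ) : ℂ)‖ ≠ 0 :=
      Finset.prod_ne_zero_iff.mpr fun j _ => by
        rw [norm_ne_zero_iff, Complex.ofReal_ne_zero]; positivity
    rw [div_div_div_eq, mul_comm, mul_div_mul_right _ _ h4]
  refine le_of_tendsto_of_tendsto (ht a ha) (ht b hb) ?_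
  filter_upwards [eventually_gt_atTop 0] with n hn
  rw [hq a ha n hn, hq b hb n hn]
  refine Finset.prod_le_prod (fun j _ => by positivity) fun j _ => ?_
  exact norm_add_I_div_le (by positivity) (by linarith)

/-- Normalising by the constant `f z` moves the value to `1`, where the principal logarithm is
differentiable; its real part is `log |f|` up to a constant. -/
theorem hasDerivAt_log_norm_comp {f : ℂ → ℂ} {z : ℂ} {σ y : ℝ} (hz : z = σ + y * Complex.I)
    (hf : DifferentiableAt ℂ f z) (h0 : f z ≠ 0) :
    HasDerivAt (fun x : ℝ => Real.log ‖f (x + y * Complex.I)‖) (logDeriv f z).re σ := by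
  have h1 : HasDerivAt (fun w : ℂ => f (w + y * Complex.I) / f z) (deriv f z / f z) (σ : ℂ) := by
    have := hf.hasDerivAt
    rw [hz] at this
    rw [hz]
    exact (this.comp_add_const _ _).div_const _
  have h2 : f ((σ : ℂ) + y * Complex.I) / f z = 1 := by rw [← hz, div_self h0]
  have h3 := (h1.clog (by rw [h2]; exact Complex.one_mem_slitPlane)).real_of_complex
  rw [h2, div_one] at h3
  have h4 : (fun x : ℝ => Real.log ‖f (x + y * Complex.I)‖) =ᶠ[𝓝 σ] fun x : ℝ =>
      (Complex.log (f (x + y * Complex.I) / f z)).re + Real.log ‖f z‖ := by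
    have hc : ContinuousAt (fun x : ℝ => f (x + y * Complex.I)) σ := by
      have hfc : ContinuousAt f ((σ : ℂ) + y * Complex.I) := hz ▸ hf.continuousAt
      exact ContinuousAt.comp (f := fun x : ℝ => (x : ℂ) + y * Complex.I) hfc (by fun_prop)
    filter_upwards [hc.eventually_ne (show f ((σ : ℂ) + y * Complex.I) ≠ 0 by rwa [← hz])]
      with x hx
    rw [Complex.log_re, norm_div, Real.log_div (norm_ne_zero_iff.mpr hx) (norm_ne_zero_iff.mpr h0)]
    ring
  rw [logDeriv_apply]
  exact (h3.add_const _).congr_of_eventuallyEq h4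

/-- This is `norm_Gamma_div_le` differentiated: the logarithm of a nondecreasing quotient has
nonnegative derivative. -/
theorem digamma_re_le (y : ℝ) {σ : ℝ} (hσ : 0 < σ) :
    (Complex.digamma σ).re ≤ (Complex.digamma (σ + y * Complex.I)).re := by
  have hd : ∀ z : ℂ, 0 < z.re → DifferentiableAt ℂ Complex.Gamma z := fun z hz =>
    Complex.differentiableAt_Gamma _ fun m h => by
      rw [h] at hz
      simp at hz
      linarith [Nat.cast_nonneg (α := ℝ) m]
  have hy : 0 < ((σ : ℂ) + y * Complex.I).re := by simpa using hσ
  have h0 : 0 < (σ : ℂ).re := by simpa using hσ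
  have h1 := hasDerivAt_log_norm_comp (f := Complex.Gamma) (σ := σ) (y := y) rfl (hd _ hy)
    (Complex.Gamma_ne_zero_of_re_pos hy)
  have h2 := hasDerivAt_log_norm_comp (f := Complex.Gamma) (z := σ) (σ := σ) (y := 0) (by simp)
    (hd _ h0) (Complex.Gamma_ne_zero_of_re_pos h0)
  simp only [Complex.ofReal_zero, zero_mul, add_zero] at h2
  have h3 := h1.sub h2
  have hmono : MonotoneOn ((fun x : ℝ => Real.log ‖Complex.Gamma (x + y * Complex.I)‖) -
      fun x : ℝ => Real.log ‖Complex.Gamma x‖) (Set.Ioi 0) := by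
    intro a ha b hb hab
    have hpos : ∀ c : ℝ, 0 < c → 0 < ‖Complex.Gamma c‖ := fun c hc =>
      norm_pos_iff.mpr (Complex.Gamma_ne_zero_of_re_pos (by simpa using hc))
    have hpos' : ∀ c : ℝ, 0 < c → 0 < ‖Complex.Gamma (c + y * Complex.I)‖ := fun c hc =>
      norm_pos_iff.mpr (Complex.Gamma_ne_zero_of_re_pos (by simpa using hc))
    simp only [Pi.sub_apply]
    rw [← Real.log_div (hpos' a ha).ne' (hpos a ha).ne',
      ← Real.log_div (hpos' b hb).ne' (hpos b hb).ne']
    exact Real.log_le_log (div_pos (hpos' a ha) (hpos a ha)) (norm_Gamma_div_le y ha hab)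
  have hacc : AccPt σ (𝓟 (Set.Ioi 0)) := by
    simpa using (PerfectSpace.univ_preperfect σ (Set.mem_univ σ)).nhds_inter (Ioi_mem_nhds hσ)
  have h4 : 0 ≤ (logDeriv Complex.Gamma (σ + y * Complex.I)).re - (logDeriv Complex.Gamma σ).re :=
    (h3.hasDerivWithinAt (s := Set.Ioi 0)).nonneg_of_monotoneOn
      hacc hmono
  exact sub_nonneg.mp h4

theorem digamma_add_natCast {s : ℂ} (hs : 0 < s.re) (n : ℕ) :
    Complex.digamma (s + n) = Complex.digamma s + ∑ j ∈ Finset.range n, (s + j)⁻¹ := by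
  induction n with
  | zero => simp
  | succ n ih =>
    have h : ∀ m : ℕ, s + n ≠ -m := fun m e => by
      have := congrArg Complex.re e
      simp at this
      have h1 := Nat.cast_nonneg (α := ℝ) n
      have h2 := Nat.cast_nonneg (α := ℝ) m
      linarith
    rw [Nat.cast_succ, ← add_assoc, Complex.digamma_apply_add_one _ h, ih, Finset.sum_range_succ,
      add_assoc]

/-- Comparing at `σ + n` and unfolding the recurrence bounds `Re digamma(σ + i y)` below by
`digamma(σ) + ∑ 1/(σ + j) - Re ∑ 1/(σ + i y + j)`, with `j < n`. The first sum is made large by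
choosing `n`; for that fixed `n` the second tends to `0` as `y → ∞`. -/
theorem tendsto_digamma_re_atTop {σ : ℝ} (hσ : 0 < σ) :
    Tendsto (fun y : ℝ => (Complex.digamma (σ + y * Complex.I)).re) atTop atTop := by
  refine tendsto_atTop.mpr fun C => ?_
  have hdiv : Tendsto (fun n : ℕ => ∑ j ∈ Finset.range n, (σ + j)⁻¹) atTop atTop := by
    refine (not_summable_iff_tendsto_nat_atTop_of_nonneg fun j => by positivity).mp ?_
    intro hsum
    obtain ⟨m, hm⟩ := exists_nat_ge σ
    have h1 : Summable fun j : ℕ => ((m : ℝ) + 1 + j)⁻¹ := by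
      refine Summable.of_nonneg_of_le (fun j => by positivity) (fun j => ?_) hsum
      exact inv_anti₀ (by positivity) (by linarith)
    refine Real.not_summable_natCast_inv ((summable_nat_add_iff (m + 1)).mp (h1.congr fun j => ?_))
    push_cast
    ring
  obtain ⟨n, hn⟩ := (hdiv.eventually_ge_atTop (C + 1 - (Complex.digamma σ).re)).exists
  have hsmall : Tendsto (fun y : ℝ => (∑ j ∈ Finset.range n, ((σ : ℂ) + y * Complex.I + j)⁻¹).re)
      atTop (𝓝 0) := by
    have : ∀ j ∈ Finset.range n,
        Tendsto (fun y : ℝ => ((σ : ℂ) + y * Complex.I + j)⁻¹) atTop (𝓝 0) := by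
      intro j _
      refine tendsto_inv₀_cobounded.comp ?_
      rw [← tendsto_norm_atTop_iff_cobounded]
      refine tendsto_atTop_mono (fun y => ?_) tendsto_id
      have := Complex.abs_im_le_norm ((σ : ℂ) + y * Complex.I + j)
      simp at this
      exact (le_abs_self y).trans this
    have := Complex.continuous_re.continuousAt.tendsto.comp (tendsto_finsetSum _ this)
    simpa [Function.comp_def] using this
  filter_upwards [hsmall.eventually_lt_const one_pos] with y hy
  have h1 := digamma_re_le y (σ := σ + n) (by positivity)
  have h2 := digamma_add_natCast (s := (σ : ℂ)) (by simpa using hσ) n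
  have h3 := digamma_add_natCast (s := (σ : ℂ) + y * Complex.I) (by simpa using hσ) n
  have e1 : ((σ + n : ℝ) : ℂ) = σ + n := by push_cast; ring
  have e2 : ((σ + n : ℝ) : ℂ) + y * Complex.I = σ + y * Complex.I + n := by push_cast; ring
  rw [e2, e1, h2, h3, Complex.add_re, Complex.add_re] at h1
  have e3 : (∑ j ∈ Finset.range n, ((σ : ℂ) + j)⁻¹).re = ∑ j ∈ Finset.range n, (σ + j)⁻¹ := by
    rw [← Complex.ofReal_re (∑ j ∈ Finset.range n, (σ + (j : ℝ))⁻¹)]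
    push_cast
    rfl
  rw [e3] at h1
  linarith

/-! ### Compatibility of Gamma factors and `L`-functions with conjugation. -/

theorem ofReal_cpow_conj {x : ℝ} (hx : 0 < x) (s : ℂ) :
    (x : ℂ) ^ (conj s) = conj ((x : ℂ) ^ s) := by
  rw [Complex.cpow_conj _ _ (by rw [Complex.arg_ofReal_of_nonneg hx.le]; exact Real.pi_pos.ne),
    Complex.conj_ofReal]

theorem Gammaℝ_conj (s : ℂ) : Complex.Gammaℝ (conj s) = conj (Complex.Gammaℝ s) := by
  have h1 : -(conj s) / 2 = conj (-s / 2) := by simp [Complex.conj_ofNat]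
  have h2 : (conj s) / 2 = conj (s / 2) := by simp [Complex.conj_ofNat]
  rw [Complex.Gammaℝ_def, Complex.Gammaℝ_def, map_mul, h1, h2, ofReal_cpow_conj Real.pi_pos,
    Complex.Gamma_conj]

theorem LSeries_conj {f : ℕ → ℂ} (hf : ∀ n, conj (f n) = f n) (s : ℂ) :
    LSeries f (conj s) = conj (LSeries f s) := by
  rw [LSeries, LSeries, Complex.conj_tsum]
  refine tsum_congr fun n => ?_
  rcases eq_or_ne n 0 with rfl | hn
  · simp
  · rw [LSeries.term_of_ne_zero hn, LSeries.term_of_ne_zero hn, map_div₀, hf]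
    have := ofReal_cpow_conj (x := n) (by positivity) s
    push_cast at this
    rw [this]

/-- The Dirichlet series has real coefficients, which settles `Re s > 1`; the identity theorem
extends this to the connected set `ℂ \ {1}`. -/
theorem LFunction_conj {N : ℕ} [NeZero N] {χ : DirichletCharacter ℂ N}
    (hχ : ∀ a, conj (χ a) = χ a) {s : ℂ} (hs : s ≠ 1) :
    χ.LFunction (conj s) = conj (χ.LFunction s) := by
  have hpc : IsPreconnected ({1}ᶜ : Set ℂ) :=
    (isConnected_compl_singleton_of_one_lt_rank (Complex.rank_real_complex ▸ Nat.one_lt_ofNat) _)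
      |>.isPreconnected
  have hd : ∀ z : ℂ, z ≠ 1 → DifferentiableAt ℂ χ.LFunction z := fun z hz =>
    DirichletCharacter.differentiableAt_LFunction _ _ (.inl hz)
  have hE : Set.EqOn (fun z => conj (χ.LFunction (conj z))) χ.LFunction {1}ᶜ := by
    refine AnalyticOnNhd.eqOn_of_preconnected_of_eventuallyEq (𝕜 := ℂ) ?_ ?_ hpc
      (show (2 : ℂ) ∈ ({1}ᶜ : Set ℂ) by simp) ?_
    · refine DifferentiableOn.analyticOnNhd (fun z hz => ?_) isOpen_compl_singleton
      have hz' : conj z ≠ 1 := fun h => hz (by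
        have := congrArg conj h
        simpa using this)
      exact (differentiableAt_conj_conj_iff.mpr (hd _ hz')).differentiableWithinAt
    · exact DifferentiableOn.analyticOnNhd
        (fun z hz => (hd z hz).differentiableWithinAt) isOpen_compl_singleton
    · refine eventually_of_mem ((Complex.continuous_re.isOpen_preimage _ isOpen_Ioi).mem_nhds
        (by simp : 1 < (2 : ℂ).re)) fun t (ht : 1 < t.re) => ?_
      have ht' : 1 < (conj t).re := by simpa using ht
      simp only
      rw [DirichletCharacter.LFunction_eq_LSeries _ ht', DirichletCharacter.LFunction_eq_LSeries _ ht,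
        LSeries_conj fun n => hχ n, Complex.conj_conj]
  have := congrArg conj (hE hs)
  simpa using this

/-! ### The quadratic character modulo `5` and its functional equation. -/

section QuadraticModFive

variable {ψ : DirichletCharacter ℂ 5}

theorem apply_three (hψ : ψ 2 = -1) : ψ 3 = -1 := by
  have h : (3 : ZMod 5) = 2 * 2 * 2 := by decide
  rw [h, map_mul, map_mul, hψ]; norm_num

theorem apply_four (hψ : ψ 2 = -1) : ψ 4 = 1 := by
  have h : (4 : ZMod 5) = 2 * 2 := by decide
  rw [h, map_mul, hψ]; norm_num

theorem apply_zero_modFive : ψ 0 = 0 := ψ.map_nonunit (by decide)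

theorem conj_apply (hψ : ψ 2 = -1) (a : ZMod 5) : conj (ψ a) = ψ a := by
  have h3 := apply_three hψ
  have h4 := apply_four hψ
  have h0 := apply_zero_modFive (ψ := ψ)
  fin_cases a
  · change conj (ψ 0) = ψ 0; simp [h0]
  · change conj (ψ 1) = ψ 1; simp
  · change conj (ψ 2) = ψ 2; simp [hψ]
  · change conj (ψ 3) = ψ 3; simp [h3]
  · change conj (ψ 4) = ψ 4; simp [h4]

theorem ne_one_of_apply_two (hψ : ψ 2 = -1) : ψ ≠ 1 := by
  rintro rfl
  rw [MulChar.one_apply (show IsUnit (2 : ZMod 5) by decide)] at hψ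
  norm_num at hψ

theorem even_of_apply_two (hψ : ψ 2 = -1) : ψ.Even := by
  have h : (-1 : ZMod 5) = 4 := by decide
  rw [DirichletCharacter.Even, h, apply_four hψ]

theorem inv_eq_self_of_apply_two (hψ : ψ 2 = -1) : ψ⁻¹ = ψ := by
  ext a
  rw [MulChar.inv_apply_eq_inv']
  have h := conj_apply hψ a
  have hn : ‖ψ a‖ = 1 := DirichletCharacter.unit_norm_eq_one ψ a
  rw [Complex.inv_def, Complex.normSq_eq_norm_sq, hn, h]
  simp

theorem isPrimitive_of_apply_two (hψ : ψ 2 = -1) : ψ.IsPrimitive := by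
  rw [DirichletCharacter.isPrimitive_def]
  rcases (Nat.dvd_prime Nat.prime_five).mp (DirichletCharacter.conductor_dvd_level ψ) with h | h
  · exact absurd (DirichletCharacter.eq_one_iff_conductor_eq_one.mpr h) (ne_one_of_apply_two hψ)
  · exact h

theorem gaussSum_of_apply_two (hψ : ψ 2 = -1) :
    gaussSum ψ (ZMod.stdAddChar (N := 5)) = ((√5 : ℝ) : ℂ) := by
  have h0 := apply_zero_modFive (ψ := ψ)
  have h3 := apply_three hψ
  have h4 := apply_four hψ
  have e : ∀ j : ℤ, ZMod.stdAddChar (N := 5) (j : ZMod 5) =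
      Complex.exp (((2 * Real.pi * j / 5 : ℝ) : ℂ) * Complex.I) := by
    intro j
    rw [ZMod.stdAddChar_coe]
    congr 1
    push_cast
    ring
  have e1 := e 1
  have e2 := e 2
  have e3 := e (-2)
  have e4 := e (-1)
  -- Writing `3` and `4` as `-2` and `-1` makes the sines cancel; there remains `2 cos(2π/5) - 2
  -- cos(4π/5) = √5`.
  have h3' : ((-2 : ℤ) : ZMod 5) = 3 := by decide
  have h4' : ((-1 : ℤ) : ZMod 5) = 4 := by decide
  rw [h3'] at e3
  rw [h4'] at e4
  have hsum : gaussSum ψ (ZMod.stdAddChar (N := 5)) =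
      ψ 0 * ZMod.stdAddChar (N := 5) 0 + ψ 1 * ZMod.stdAddChar (N := 5) 1 +
      ψ 2 * ZMod.stdAddChar (N := 5) 2 + ψ 3 * ZMod.stdAddChar (N := 5) 3 +
      ψ 4 * ZMod.stdAddChar (N := 5) 4 := Fin.sum_univ_five _
  rw [Int.cast_one] at e1
  rw [Int.cast_ofNat] at e2
  rw [hsum, h0, hψ, h3, h4, map_one, e1, e2, e3, e4]
  simp only [Complex.exp_mul_I, ← Complex.ofReal_cos, ← Complex.ofReal_sin]
  have c1 : Real.cos (2 * Real.pi * (1 : ℤ) / 5) = (√5 - 1) / 4 := by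
    have : (2 * Real.pi * (1 : ℤ) / 5) = 2 * (Real.pi / 5) := by push_cast; ring
    rw [this, Real.cos_two_mul, Real.cos_pi_div_five]
    have := Real.sq_sqrt (show (0 : ℝ) ≤ 5 by norm_num)
    linear_combination this / 8
  have c2 : Real.cos (2 * Real.pi * (2 : ℤ) / 5) = -(1 + √5) / 4 := by
    have : (2 * Real.pi * (2 : ℤ) / 5) = Real.pi - Real.pi / 5 := by push_cast; ring
    rw [this, Real.cos_pi_sub, Real.cos_pi_div_five]
    ring
  have m1 : (2 * Real.pi * (-1 : ℤ) / 5) = -(2 * Real.pi * (1 : ℤ) / 5) := by push_cast; ring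
  have m2 : (2 * Real.pi * (-2 : ℤ) / 5) = -(2 * Real.pi * (2 : ℤ) / 5) := by push_cast; ring
  rw [m1, m2, Real.cos_neg, Real.cos_neg, Real.sin_neg, Real.sin_neg, c1, c2]
  push_cast
  ring

theorem completedLFunction_one_sub_of_apply_two (hψ : ψ 2 = -1) (s : ℂ) :
    ψ.completedLFunction (1 - s) = (5 : ℂ) ^ (s - 1 / 2) * ψ.completedLFunction s := by
  have h := (isPrimitive_of_apply_two hψ).completedLFunction_one_sub s
  have hr : ψ.rootNumber = 1 := by
    rw [DirichletCharacter.rootNumber, if_pos (even_of_apply_two hψ), gaussSum_of_apply_two hψ,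
      pow_zero, div_one, Real.sqrt_eq_rpow, Complex.ofReal_cpow (by norm_num)]
    push_cast
    exact div_self (by simp)
  rw [h, hr, inv_eq_self_of_apply_two hψ]
  push_cast
  ring

end QuadraticModFive

/-! ### The completed family and its symmetry about the critical line. -/

/-- The factor `5^(s/2) Γ_ℝ(s)` completing `zetaFamily`. -/
noncomputable def completingFactor (s : ℂ) : ℂ := (5 : ℂ) ^ (s / 2) * Complex.Gammaℝ s

/-- The completed form of `(1 + √5 / 5^s) ζ(s)`. -/
noncomputable def completedZetaPart (s : ℂ) : ℂ :=
  ((5 : ℂ) ^ (s / 2) + (5 : ℂ) ^ ((1 - s) / 2)) * completedRiemannZeta s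

/-- The completed form of `L(s, ψ)`. -/
noncomputable def completedLPart (ψ : DirichletCharacter ℂ 5) (s : ℂ) : ℂ :=
  (5 : ℂ) ^ (s / 2) * ψ.completedLFunction s

theorem Gammaℝ_ne_zero_of_im_ne_zero {s : ℂ} (hs : s.im ≠ 0) : Complex.Gammaℝ s ≠ 0 := by
  intro h
  obtain ⟨n, hn⟩ := Complex.Gammaℝ_eq_zero_iff.mp h
  exact hs (by simp [hn])

theorem completingFactor_ne_zero {s : ℂ} (hs : s.im ≠ 0) : completingFactor s ≠ 0 :=
  mul_ne_zero (by simp [Complex.cpow_eq_zero_iff]) (Gammaℝ_ne_zero_of_im_ne_zero hs)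

theorem ne_ofReal_of_im_ne_zero {s : ℂ} (hs : s.im ≠ 0) (x : ℝ) : s ≠ x :=
  fun h => hs (by simp [h])

theorem completedRiemannZeta_conj {s : ℂ} (hs : s.im ≠ 0) :
    completedRiemannZeta (conj s) = conj (completedRiemannZeta s) := by
  have key : ∀ z : ℂ, z.im ≠ 0 → completedRiemannZeta z = riemannZeta z * Complex.Gammaℝ z := by
    intro z hz
    rw [riemannZeta_def_of_ne_zero (by simpa using ne_ofReal_of_im_ne_zero hz 0),
      div_mul_cancel₀ _ (Gammaℝ_ne_zero_of_im_ne_zero hz)]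
  rw [key s hs, key _ (by simpa using hs), map_mul, Gammaℝ_conj,
    riemannZeta_conj]

theorem completedLFunction_eq_mul_Gammaℝ {ψ : DirichletCharacter ℂ 5} (hψ : ψ 2 = -1) {z : ℂ}
    (hz : z.im ≠ 0) : ψ.completedLFunction z = ψ.LFunction z * Complex.Gammaℝ z := by
  rw [DirichletCharacter.LFunction_eq_completed_div_gammaFactor _ _ (Or.inr (by norm_num)),
    (even_of_apply_two hψ).gammaFactor_def, div_mul_cancel₀ _ (Gammaℝ_ne_zero_of_im_ne_zero hz)]

theorem completedLFunction_conj {ψ : DirichletCharacter ℂ 5} (hψ : ψ 2 = -1) {s : ℂ}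
    (hs : s.im ≠ 0) : ψ.completedLFunction (conj s) = conj (ψ.completedLFunction s) := by
  rw [completedLFunction_eq_mul_Gammaℝ hψ hs,
    completedLFunction_eq_mul_Gammaℝ hψ (z := conj s) (by simpa using hs), map_mul,
    Gammaℝ_conj, LFunction_conj (conj_apply hψ) (by simpa using ne_ofReal_of_im_ne_zero hs 1)]

theorem five_cpow_conj (s : ℂ) : (5 : ℂ) ^ (conj s) = conj ((5 : ℂ) ^ s) := by
  have := ofReal_cpow_conj (x := 5) (by norm_num) s
  push_cast at this
  exact this

theorem completedZetaPart_one_sub_conj {s : ℂ} (hs : s.im ≠ 0) :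
    completedZetaPart (1 - conj s) = conj (completedZetaPart s) := by
  have h1 : (1 - conj s) / 2 = conj ((1 - s) / 2) := by simp [Complex.conj_ofNat]
  have h2 : (1 - (1 - conj s)) / 2 = conj (s / 2) := by simp [Complex.conj_ofNat]
  rw [completedZetaPart, completedZetaPart, completedRiemannZeta_one_sub,
    completedRiemannZeta_conj hs, h1, h2, five_cpow_conj, five_cpow_conj, map_mul, map_add]
  ring

/-- The root number is `1`, and the factor `5^(s/2)` absorbs the conductor, since `(1 - s)/2 + (s -
1/2) = s/2`. -/
theorem completedLPart_one_sub_conj {ψ : DirichletCharacter ℂ 5} (hψ : ψ 2 = -1) {s : ℂ}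
    (hs : s.im ≠ 0) : completedLPart ψ (1 - conj s) = conj (completedLPart ψ s) := by
  rw [completedLPart, completedLPart, completedLFunction_one_sub_of_apply_two hψ,
    completedLFunction_conj hψ hs, map_mul, ← five_cpow_conj, ← mul_assoc,
    ← Complex.cpow_add _ _ (by norm_num)]
  congr 2
  simp only [map_div₀, Complex.conj_ofNat]
  ring

/-- The point is `5^(s/2) (1 + √5 / 5^s) = 5^(s/2) + 5^((1-s)/2)`, so one factor completes both
summands. -/
theorem zetaFamily_mul_completingFactor {ψ : DirichletCharacter ℂ 5} (hψ : ψ 2 = -1) {s : ℂ}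
    (hs : s.im ≠ 0) (τ : ℝ) :
    zetaFamily ψ s τ * completingFactor s =
      (1 - (τ : ℂ)) * completedZetaPart s + τ * completedLPart ψ s := by
  have h1 : riemannZeta s * Complex.Gammaℝ s = completedRiemannZeta s := by
    rw [riemannZeta_def_of_ne_zero (by simpa using ne_ofReal_of_im_ne_zero hs 0),
      div_mul_cancel₀ _ (Gammaℝ_ne_zero_of_im_ne_zero hs)]
  have h2 := completedLFunction_eq_mul_Gammaℝ hψ hs
  have h5 : (5 : ℂ) ≠ 0 := by norm_num
  have hne : (5 : ℂ) ^ (s / 2) ≠ 0 := by simp [Complex.cpow_eq_zero_iff]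
  have h3 : (5 : ℂ) ^ s = (5 : ℂ) ^ (s / 2) * (5 : ℂ) ^ (s / 2) := by
    rw [← Complex.cpow_add _ _ h5, add_halves]
  have h4 : (5 : ℂ) ^ ((1 - s) / 2) = ((√5 : ℝ) : ℂ) / (5 : ℂ) ^ (s / 2) := by
    rw [sub_div, Complex.cpow_sub _ _ h5, Real.sqrt_eq_rpow, Complex.ofReal_cpow (by norm_num)]
    push_cast
    rfl
  rw [completedZetaPart, completedLPart, h2, ← h1, h4, zetaFamily, completingFactor, h3]
  field_simp

/-! ### The logarithmic derivative of the completing factor. -/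

theorem logDeriv_const_cpow_mul {c : ℂ} (hc : c ≠ 0) (a s : ℂ) :
    logDeriv (fun s : ℂ => c ^ (a * s)) s = a * Complex.log c := by
  have h : HasDerivAt (fun s : ℂ => c ^ (a * s)) (c ^ (a * s) * Complex.log c * a) s := by
    have := ((hasDerivAt_id' s).const_mul a).const_cpow (c := c) (Or.inl hc)
    simpa using this
  have hne : c ^ (a * s) ≠ 0 := by simp [Complex.cpow_eq_zero_iff, hc]
  rw [logDeriv_apply, h.deriv]
  field_simp

theorem half_ne_neg_natCast {s : ℂ} (hs : s.im ≠ 0) (m : ℕ) : s / 2 ≠ -(m : ℂ) := by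
  intro h
  have h1 : s = ((-(2 * m) : ℝ) : ℂ) := by push_cast; linear_combination 2 * h
  exact hs (by rw [h1]; exact Complex.ofReal_im _)

theorem differentiableAt_Gamma_half {s : ℂ} (hs : s.im ≠ 0) :
    DifferentiableAt ℂ (fun s => Complex.Gamma (s / 2)) s := by
  have h1 := Complex.differentiableAt_Gamma _ (half_ne_neg_natCast hs)
  exact DifferentiableAt.fun_comp' s h1 (by fun_prop)

theorem completingFactor_eq : completingFactor = fun s : ℂ =>
    (5 : ℂ) ^ ((1 / 2) * s) * ((Real.pi : ℂ) ^ ((-1 / 2) * s) * Complex.Gamma (s / 2)) := by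
  funext s
  rw [completingFactor, Complex.Gammaℝ_def]
  congr 3 <;> ring

theorem pi_ne_zero_complex : (Real.pi : ℂ) ≠ 0 := Complex.ofReal_ne_zero.mpr Real.pi_ne_zero

theorem differentiableAt_const_cpow_mul {c : ℂ} (hc : c ≠ 0) (a s : ℂ) :
    DifferentiableAt ℂ (fun s : ℂ => c ^ (a * s)) s :=
  (differentiableAt_id.const_mul a).const_cpow (Or.inl hc)

theorem differentiableAt_completingFactor {s : ℂ} (hs : s.im ≠ 0) :
    DifferentiableAt ℂ completingFactor s := by
  rw [completingFactor_eq]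
  exact (differentiableAt_const_cpow_mul (by norm_num) _ _).mul
    ((differentiableAt_const_cpow_mul pi_ne_zero_complex _ _).mul
    (differentiableAt_Gamma_half hs))

theorem logDeriv_completingFactor {s : ℂ} (hs : s.im ≠ 0) :
    logDeriv completingFactor s =
      (Complex.log 5 - Complex.log Real.pi + Complex.digamma (s / 2)) / 2 := by
  have h5 : (5 : ℂ) ≠ 0 := by norm_num
  have hG : Complex.Gamma (s / 2) ≠ 0 := Complex.Gamma_ne_zero (half_ne_neg_natCast hs)
  have hc : ∀ {c : ℂ}, c ≠ 0 → ∀ z : ℂ, c ^ z ≠ 0 := fun hc z => by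
    simp [Complex.cpow_eq_zero_iff, hc]
  have hπ := differentiableAt_const_cpow_mul pi_ne_zero_complex (-1 / 2) s
  have hΓ : logDeriv (fun s => Complex.Gamma (s / 2)) s = Complex.digamma (s / 2) / 2 := by
    have h1 := Complex.differentiableAt_Gamma _ (half_ne_neg_natCast hs)
    have h2 := logDeriv_comp (f := Complex.Gamma) (g := fun s : ℂ => s / 2) (x := s) h1
      (by fun_prop)
    have h3 : deriv (fun s : ℂ => s / 2) s = 1 / 2 := by simp
    rw [h3] at h2
    rw [Complex.digamma_def, div_eq_mul_one_div]
    exact h2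
  have hinner : (Real.pi : ℂ) ^ ((-1 / 2) * s) * Complex.Gamma (s / 2) ≠ 0 :=
    mul_ne_zero (hc pi_ne_zero_complex _) hG
  have h1 := logDeriv_mul (f := fun s => (5 : ℂ) ^ ((1 / 2) * s))
    (g := fun s => (Real.pi : ℂ) ^ ((-1 / 2) * s) * Complex.Gamma (s / 2)) s (hc h5 _) hinner
    (differentiableAt_const_cpow_mul h5 _ _) (hπ.fun_mul (differentiableAt_Gamma_half hs))
  have h2 := logDeriv_mul (f := fun s => (Real.pi : ℂ) ^ ((-1 / 2) * s))
    (g := fun s => Complex.Gamma (s / 2)) s (hc pi_ne_zero_complex _) hG hπ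
    (differentiableAt_Gamma_half hs)
  rw [completingFactor_eq, h1, h2, logDeriv_const_cpow_mul h5,
    logDeriv_const_cpow_mul pi_ne_zero_complex, hΓ]
  ring

theorem exists_forall_logDeriv_completingFactor_re_pos :
    ∃ T : ℝ, 0 ≤ T ∧ ∀ s : ℂ, s.re = 1 / 2 → T < s.im → 0 < (logDeriv completingFactor s).re := by
  have h := tendsto_digamma_re_atTop (σ := 1 / 4) (by norm_num)
  obtain ⟨Y, hY⟩ := eventually_atTop.mp (h.eventually_ge_atTop 0)
  -- The digamma argument is `s / 2 = 1/4 + i (Im s)/2`, hence `2 * Y`; the `0` keeps `s` off the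
  -- real axis.
  refine ⟨max 0 (2 * Y), le_max_left _ _, fun s hre him => ?_⟩
  have him0 : 0 < s.im := (le_max_left _ _).trans_lt him
  have hsY : Y ≤ s.im / 2 := by linarith [(le_max_right 0 (2 * Y)).trans him.le]
  have hd := hY _ hsY
  have hs : s / 2 = ((1 / 4 : ℝ) : ℂ) + ((s.im / 2 : ℝ) : ℂ) * Complex.I := by
    apply Complex.ext <;> simp [hre]
    norm_num
  rw [← hs] at hd
  rw [logDeriv_completingFactor him0.ne']
  have h5 : Complex.log 5 = (Real.log 5 : ℝ) := by
    rw [Complex.ofReal_log (by norm_num)]; norm_num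
  have hπ : Complex.log Real.pi = (Real.log Real.pi : ℝ) := by
    rw [Complex.ofReal_log Real.pi_pos.le]
  have hlt : Real.log Real.pi < Real.log 5 :=
    Real.log_lt_log Real.pi_pos (Real.pi_lt_four.trans (by norm_num))
  rw [h5, hπ, ← Complex.ofReal_sub, Complex.div_ofNat_re, Complex.add_re, Complex.ofReal_re]
  linarith

/-! ### Trajectories on and off the critical line as germs. -/

/-- Passing from trajectories near a point of the critical line to germs of solutions in the
coordinate `s = ρ₀ + i u`. -/
theorem exists_isZeroTrajectory_iff_hasZeroGerm {g G : ℂ → ℝ → ℂ} {ρ₀ : ℂ} {τ₀ : ℝ}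
    {p q p' q' : ℝ → Prop} (hre : ρ₀.re = 1 / 2)
    (hg : ∀ᶠ s in 𝓝 ρ₀, ∀ τ : ℝ, AnalyticAt ℂ (fun s => g s τ) s)
    (hG : ∀ᶠ u in 𝓝 (0 : ℂ), ∀ ε : ℝ, g (ρ₀ + Complex.I * u) (τ₀ + ε) = 0 ↔ G u ε = 0)
    (hp : ∀ y, p' (1 / 2 - y) ↔ p y) (hq : ∀ y, q' (1 / 2 - y) ↔ q y) :
    (∃ (θ : ℝ) (ρ : ℝ → ℂ), IsZeroTrajectory g ρ τ₀ θ ∧ ρ τ₀ = ρ₀ ∧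
      (∀ τ ∈ Set.Ioo (τ₀ - θ) τ₀, p' (ρ τ).re) ∧ (∀ τ ∈ Set.Ioo τ₀ (τ₀ + θ), q' (ρ τ).re)) ↔
    HasZeroGerm G p q := by
  have hline : ∀ u : ℂ, (ρ₀ + Complex.I * u).re = 1 / 2 - u.im := fun u => by
    simp [hre]; ring
  have hcoord : ∀ z : ℂ, ρ₀ + Complex.I * (-Complex.I * (z - ρ₀)) = z := fun z => by
    linear_combination -(z - ρ₀) * Complex.I_sq
  constructor
  · rintro ⟨θ, ρ, ⟨hθ, hc, hz⟩, h0, hL, hR⟩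
    have hmem : ∀ ε ∈ Set.Ioo (-θ) θ, τ₀ + ε ∈ Set.Ioo (τ₀ - θ) (τ₀ + θ) := fun ε hε =>
      ⟨by linarith [hε.1], by linarith [hε.2]⟩
    have hnhds : ∀ᶠ ε in 𝓝 (0 : ℝ), ε ∈ Set.Ioo (-θ) θ :=
      Ioo_mem_nhds (by linarith) hθ
    set u : ℝ → ℂ := fun ε => -Complex.I * (ρ (τ₀ + ε) - ρ₀) with hu
    have hu0 : u 0 = 0 := by simp [hu, h0]
    have huρ : ∀ ε, ρ₀ + Complex.I * u ε = ρ (τ₀ + ε) := fun ε => hcoord _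
    have huc : ∀ᶠ ε in 𝓝 (0 : ℝ), ContinuousAt u ε := by
      filter_upwards [hnhds] with ε hε
      have h1 : ContinuousAt ρ (τ₀ + ε) := hc.continuousAt (isOpen_Ioo.mem_nhds (hmem ε hε))
      have h2 : ContinuousAt (fun ε => ρ (τ₀ + ε)) ε :=
        ContinuousAt.comp (f := fun ε => τ₀ + ε) h1 (by fun_prop)
      exact continuousAt_const.mul (h2.sub continuousAt_const)
    have hut := tendsto_zero_of_germ hu0 huc
    refine ⟨u, hu0, huc, ?_, ?_, ?_⟩
    · filter_upwards [hnhds, hut.eventually hG] with ε hε h1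
      rw [← h1, huρ]
      exact (hz _ (hmem ε hε)).2
    · filter_upwards [self_mem_nhdsWithin, nhdsWithin_le_nhds hnhds] with ε hlt hε
      rw [← hp, ← hline, huρ]
      exact hL _ ⟨(hmem ε hε).1, by linarith [Set.mem_Iio.mp hlt]⟩
    · filter_upwards [self_mem_nhdsWithin, nhdsWithin_le_nhds hnhds] with ε hlt hε
      rw [← hq, ← hline, huρ]
      exact hR _ ⟨by linarith [Set.mem_Ioi.mp hlt], (hmem ε hε).2⟩
  · rintro ⟨u, hu0, huc, hu, hL, hR⟩
    have hut := tendsto_zero_of_germ hu0 huc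
    have hρt : Tendsto (fun ε => ρ₀ + Complex.I * u ε) (𝓝 0) (𝓝 ρ₀) := by
      have := (hut.const_mul Complex.I).const_add ρ₀
      rwa [mul_zero, add_zero] at this
    obtain ⟨θ, hθ, hall⟩ := Metric.eventually_nhds_iff.mp
      (huc.and (hu.and ((eventually_nhdsWithin_iff.mp hL).and ((eventually_nhdsWithin_iff.mp hR).and
        ((hρt.eventually hg).and (hut.eventually hG))))))
    have hmem : ∀ τ ∈ Set.Ioo (τ₀ - θ) (τ₀ + θ), dist (τ - τ₀) 0 < θ := fun τ hτ => by
      rw [Real.dist_eq, sub_zero, abs_lt]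
      exact ⟨by linarith [hτ.1], by linarith [hτ.2]⟩
    refine ⟨θ, fun τ => ρ₀ + Complex.I * u (τ - τ₀), ⟨hθ, ?_, ?_⟩, by simp [hu0], ?_, ?_⟩
    · intro τ hτ
      have h1 : ContinuousAt (fun τ => u (τ - τ₀)) τ :=
        ContinuousAt.comp (f := fun τ => τ - τ₀) (hall (hmem τ hτ)).1 (by fun_prop)
      exact (continuousAt_const.add (continuousAt_const.mul h1)).continuousWithinAt
    · intro τ hτ
      obtain ⟨-, h2, -, -, h5, h6⟩ := hall (hmem τ hτ)
      refine ⟨h5 τ, ?_⟩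
      have := (h6 (τ - τ₀)).mpr h2
      rwa [add_sub_cancel] at this
    · intro τ hτ
      have h := (hall (hmem τ ⟨hτ.1, by linarith [hτ.2]⟩)).2.2.1
      rw [hline, hp]
      exact h (by simpa using hτ.2)
    · intro τ hτ
      have h := (hall (hmem τ ⟨by linarith [hτ.1], hτ.2⟩)).2.2.2.1
      rw [hline, hq]
      exact h (by simpa using hτ.1)

/-! ### Analyticity off the real axis and the completed derivative. -/

theorem differentiableAt_completedZetaPart {s : ℂ} (hs : s.im ≠ 0) :
    DifferentiableAt ℂ completedZetaPart s := by
  have h5 : (5 : ℂ) ≠ 0 := by norm_num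
  have h1 : DifferentiableAt ℂ (fun s : ℂ => (5 : ℂ) ^ (s / 2)) s :=
    DifferentiableAt.const_cpow (by fun_prop) (Or.inl h5)
  have h2 : DifferentiableAt ℂ (fun s : ℂ => (5 : ℂ) ^ ((1 - s) / 2)) s :=
    DifferentiableAt.const_cpow (by fun_prop) (Or.inl h5)
  exact (h1.fun_add h2).fun_mul (differentiableAt_completedZeta
    (by simpa using ne_ofReal_of_im_ne_zero hs 0) (by simpa using ne_ofReal_of_im_ne_zero hs 1))

theorem differentiableAt_completedLPart {ψ : DirichletCharacter ℂ 5} (hψ : ψ 2 = -1) (s : ℂ) :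
    DifferentiableAt ℂ (completedLPart ψ) s := by
  have h1 : DifferentiableAt ℂ (fun s : ℂ => (5 : ℂ) ^ (s / 2)) s :=
    DifferentiableAt.const_cpow (by fun_prop) (Or.inl (by norm_num))
  exact h1.fun_mul (DirichletCharacter.differentiable_completedLFunction (ne_one_of_apply_two hψ) s)

theorem isOpen_im_ne_zero : IsOpen {s : ℂ | s.im ≠ 0} :=
  isOpen_ne.preimage Complex.continuous_im

theorem analyticAt_of_differentiableAt_im_ne_zero {f : ℂ → ℂ}
    (hf : ∀ s : ℂ, s.im ≠ 0 → DifferentiableAt ℂ f s) {s : ℂ} (hs : s.im ≠ 0) :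
    AnalyticAt ℂ f s :=
  DifferentiableOn.analyticAt (fun z hz => (hf z hz).differentiableWithinAt)
    (isOpen_im_ne_zero.mem_nhds hs)

theorem analyticAt_zetaFamily {ψ : DirichletCharacter ℂ 5} (hψ : ψ 2 = -1) {s : ℂ}
    (hs : s.im ≠ 0) (τ : ℝ) : AnalyticAt ℂ (fun s => zetaFamily ψ s τ) s := by
  have h1 : AnalyticAt ℂ (fun s => ((1 - (τ : ℂ)) * completedZetaPart s +
      τ * completedLPart ψ s) / completingFactor s) s := by
    refine AnalyticAt.fun_div ?_ (analyticAt_of_differentiableAt_im_ne_zero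
      (fun _ => differentiableAt_completingFactor) hs) (completingFactor_ne_zero hs)
    exact (analyticAt_const.mul (analyticAt_of_differentiableAt_im_ne_zero
      (fun _ => differentiableAt_completedZetaPart) hs)).add (analyticAt_const.mul
      (analyticAt_of_differentiableAt_im_ne_zero (fun s _ => differentiableAt_completedLPart hψ s) hs))
  refine h1.congr ?_
  filter_upwards [isOpen_im_ne_zero.mem_nhds hs] with z hz
  rw [← zetaFamily_mul_completingFactor hψ hz, mul_div_cancel_right₀ _ (completingFactor_ne_zero hz)]

theorem zetaFamilyDeriv_mul_completingFactor {ψ : DirichletCharacter ℂ 5} (hψ : ψ 2 = -1) {s : ℂ}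
    (hs : s.im ≠ 0) (τ : ℝ) :
    zetaFamilyDeriv ψ s τ * completingFactor s =
      (1 - (τ : ℂ)) * deriv completedZetaPart s + τ * deriv (completedLPart ψ) s -
      logDeriv completingFactor s *
        ((1 - (τ : ℂ)) * completedZetaPart s + τ * completedLPart ψ s) := by
  have hev : (fun s => zetaFamily ψ s τ * completingFactor s) =ᶠ[𝓝 s] fun s =>
      (1 - (τ : ℂ)) * completedZetaPart s + τ * completedLPart ψ s := by
    filter_upwards [isOpen_im_ne_zero.mem_nhds hs] with z hz
    exact zetaFamily_mul_completingFactor hψ hz τ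
  have h1 := ((analyticAt_zetaFamily hψ hs τ).differentiableAt.hasDerivAt.fun_mul
    (differentiableAt_completingFactor hs).hasDerivAt).deriv
  have h2 := (((differentiableAt_completedZetaPart hs).hasDerivAt.const_mul (1 - (τ : ℂ))).fun_add
    ((differentiableAt_completedLPart hψ s).hasDerivAt.const_mul (τ : ℂ))).deriv
  rw [hev.deriv_eq, h2] at h1
  rw [h1, ← zetaFamily_mul_completingFactor hψ hs, zetaFamilyDeriv, logDeriv_apply]
  have := completingFactor_ne_zero hs
  field_simp
  ring

theorem hasDerivAt_comp_line {f : ℂ → ℂ} {ρ₀ u : ℂ}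
    (hf : DifferentiableAt ℂ f (ρ₀ + Complex.I * u)) :
    HasDerivAt (fun u => f (ρ₀ + Complex.I * u))
      (Complex.I * deriv f (ρ₀ + Complex.I * u)) u := by
  have h1 : HasDerivAt (fun u : ℂ => ρ₀ + Complex.I * u) Complex.I u := by
    simpa using ((hasDerivAt_id' u).const_mul Complex.I).const_add ρ₀
  rw [mul_comm]
  exact HasDerivAt.comp u hf.hasDerivAt h1

/-- Under `s = ρ₀ + i u` with `Re ρ₀ = 1/2`, the reflection `s ↦ 1 - conj s` becomes `u ↦ conj u`.
-/
theorem isConjSymmAtZero_comp_line {f : ℂ → ℂ} {ρ₀ : ℂ} (hre : ρ₀.re = 1 / 2) (him : ρ₀.im ≠ 0)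
    (hf : ∀ s : ℂ, s.im ≠ 0 → f (1 - conj s) = conj (f s)) :
    IsConjSymmAtZero (fun u => f (ρ₀ + Complex.I * u)) := by
  have hc : ContinuousAt (fun u : ℂ => (ρ₀ + Complex.I * u).im) 0 := by fun_prop
  filter_upwards [hc.eventually_ne (show (ρ₀ + Complex.I * 0).im ≠ 0 by simpa using him)] with u hu
  rw [← hf _ hu]
  congr 1
  refine Complex.ext ?_ ?_
  · simp [hre]; ring
  · simp [add_comm]

/-! ### Reduction of the theorem to the local pencil. -/

theorem theorem3 (ψ : DirichletCharacter ℂ 5) (hψ : ψ 2 = -1) :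
    ∃ T₀ : ℝ, ∀ τ₀ ∈ Set.Icc (0 : ℝ) 1, ∀ ρ₀ : ℂ,
      analyticOrderAt (fun s : ℂ => zetaFamily ψ s τ₀) ρ₀ = 2 →
      ρ₀.re = 1 / 2 → T₀ < ρ₀.im →
      ((∃ (θ : ℝ) (ρ : ℝ → ℂ), IsZeroTrajectory (zetaFamily ψ) ρ τ₀ θ ∧
          ρ τ₀ = ρ₀ ∧
          (∀ τ ∈ Set.Ioo (τ₀ - θ) τ₀, (ρ τ).re = 1 / 2) ∧
          (∀ τ ∈ Set.Ioo τ₀ (τ₀ + θ), (ρ τ).re < 1 / 2)) ↔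
       (∃ (η : ℝ) (ρ' : ℝ → ℂ), IsZeroTrajectory (zetaFamilyDeriv ψ) ρ' τ₀ η ∧
          ρ' τ₀ = ρ₀ ∧
          (∀ τ ∈ Set.Ioo (τ₀ - η) τ₀, 1 / 2 < (ρ' τ).re) ∧
          (∀ τ ∈ Set.Ioo τ₀ (τ₀ + η), (ρ' τ).re < 1 / 2))) := by
  obtain ⟨T, hT, hpos⟩ := exists_forall_logDeriv_completingFactor_re_pos
  refine ⟨T, fun τ₀ _ ρ₀ hord hre him => ?_⟩
  have him0 : ρ₀.im ≠ 0 := (hT.trans_lt him).ne'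
  set A : ℂ → ℂ := fun u => completedZetaPart (ρ₀ + Complex.I * u) with hA
  set B : ℂ → ℂ := fun u => completedLPart ψ (ρ₀ + Complex.I * u) with hB
  set P : ℂ → ℂ := fun u => (1 - (τ₀ : ℂ)) * A u + τ₀ * B u with hP
  set h : ℂ → ℂ := fun u => B u - A u with hh
  set k : ℂ → ℂ := fun u => logDeriv completingFactor (ρ₀ + Complex.I * u) with hk
  have hline0 : ρ₀ + Complex.I * 0 = ρ₀ := by simp
  have hlinea : AnalyticAt ℂ (fun u : ℂ => ρ₀ + Complex.I * u) 0 := by fun_prop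
  have hcomp : ∀ {f : ℂ → ℂ}, AnalyticAt ℂ f ρ₀ →
      AnalyticAt ℂ (fun u => f (ρ₀ + Complex.I * u)) 0 := fun hf =>
    AnalyticAt.fun_comp (by rwa [hline0]) hlinea
  have hlinet : Tendsto (fun u : ℂ => ρ₀ + Complex.I * u) (𝓝 0) (𝓝 ρ₀) := by
    have := hlinea.continuousAt.tendsto
    rwa [hline0] at this
  have himev : ∀ᶠ s in 𝓝 ρ₀, s.im ≠ 0 := isOpen_im_ne_zero.mem_nhds him0
  have hAa : AnalyticAt ℂ A 0 := hcomp (analyticAt_of_differentiableAt_im_ne_zero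
    (fun _ => differentiableAt_completedZetaPart) him0)
  have hBa : AnalyticAt ℂ B 0 := hcomp (analyticAt_of_differentiableAt_im_ne_zero
    (fun s _ => differentiableAt_completedLPart hψ s) him0)
  have hEa : AnalyticAt ℂ completingFactor ρ₀ := analyticAt_of_differentiableAt_im_ne_zero
    (fun _ => differentiableAt_completingFactor) him0
  have hka : AnalyticAt ℂ k 0 := hcomp (hEa.deriv.div hEa (completingFactor_ne_zero him0))
  have hPa : AnalyticAt ℂ P 0 := (analyticAt_const.mul hAa).add (analyticAt_const.mul hBa)
  have hha : AnalyticAt ℂ h 0 := hBa.sub hAa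
  have hAs : IsConjSymmAtZero A :=
    isConjSymmAtZero_comp_line hre him0 fun _ => completedZetaPart_one_sub_conj
  have hBs : IsConjSymmAtZero B :=
    isConjSymmAtZero_comp_line hre him0 fun _ => completedLPart_one_sub_conj hψ
  have hPs : IsConjSymmAtZero P := by
    filter_upwards [hAs, hBs] with u h1 h2
    simp only [hP, h1, h2, map_add, map_mul, map_sub, map_one, Complex.conj_ofReal]
  have hhs : IsConjSymmAtZero h := by
    filter_upwards [hAs, hBs] with u h1 h2
    simp only [hh, h1, h2, map_sub]
  have hPord : analyticOrderAt P 0 = 2 := by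
    have hfa := analyticAt_zetaFamily hψ him0 τ₀
    obtain ⟨g, hg, hg0, hfg⟩ :=
      (hfa.analyticOrderAt_eq_natCast (n := 2)).mp (by exact_mod_cast hord)
    -- The sign comes from `(s - ρ₀)² = (i u)² = -u²`.
    have hgE : AnalyticAt ℂ (fun s => -(g s * completingFactor s)) ρ₀ := (hg.mul hEa).neg
    refine mod_cast (hPa.analyticOrderAt_eq_natCast (n := 2)).mpr
      ⟨fun u => -(g (ρ₀ + Complex.I * u) * completingFactor (ρ₀ + Complex.I * u)), hcomp hgE, ?_, ?_⟩
    · simp only [hline0]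
      exact neg_ne_zero.mpr (mul_ne_zero hg0 (completingFactor_ne_zero him0))
    · filter_upwards [hlinet.eventually hfg, hlinet.eventually himev] with u h1 h2
      simp only [hP, hA, hB]
      rw [← zetaFamily_mul_completingFactor hψ h2, h1, smul_eq_mul, smul_eq_mul]
      linear_combination (u ^ 2 * g (ρ₀ + Complex.I * u) *
        completingFactor (ρ₀ + Complex.I * u)) * Complex.I_sq
  have hk0 : 0 < (k 0).re := by
    simp only [hk, hline0]
    exact hpos ρ₀ hre him
  have hzero : ∀ᶠ u in 𝓝 (0 : ℂ), ∀ ε : ℝ,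
      zetaFamily ψ (ρ₀ + Complex.I * u) (τ₀ + ε) = 0 ↔ P u + (ε : ℂ) * h u = 0 := by
    filter_upwards [hlinet.eventually himev] with u hu
    intro ε
    have h1 := zetaFamily_mul_completingFactor hψ hu (τ₀ + ε)
    have h2 : P u + (ε : ℂ) * h u = zetaFamily ψ (ρ₀ + Complex.I * u) (τ₀ + ε) *
        completingFactor (ρ₀ + Complex.I * u) := by
      rw [h1]; simp only [hP, hh, hA, hB]; push_cast; ring
    rw [h2, mul_eq_zero, or_iff_left (completingFactor_ne_zero hu)]
  have hcrit : ∀ᶠ u in 𝓝 (0 : ℂ), ∀ ε : ℝ,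
      zetaFamilyDeriv ψ (ρ₀ + Complex.I * u) (τ₀ + ε) = 0 ↔
        deriv P u + (ε : ℂ) * deriv h u - Complex.I * k u * (P u + (ε : ℂ) * h u) = 0 := by
    filter_upwards [hlinet.eventually himev] with u hu
    intro ε
    have h1 := zetaFamilyDeriv_mul_completingFactor hψ hu (τ₀ + ε)
    have hAd := hasDerivAt_comp_line (differentiableAt_completedZetaPart hu)
    have hBd := hasDerivAt_comp_line (differentiableAt_completedLPart hψ (ρ₀ + Complex.I * u))
    have hPd := ((hAd.const_mul (1 - (τ₀ : ℂ))).fun_add (hBd.const_mul (τ₀ : ℂ))).deriv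
    have hhd := (hBd.fun_sub hAd).deriv
    -- The factor `i` is the chain rule `d/du = i d/ds`; it also turns `k` into `i k`.
    have h2 : deriv P u + (ε : ℂ) * deriv h u - Complex.I * k u * (P u + (ε : ℂ) * h u) =
        Complex.I * (zetaFamilyDeriv ψ (ρ₀ + Complex.I * u) (τ₀ + ε) *
          completingFactor (ρ₀ + Complex.I * u)) := by
      rw [h1, show deriv P u = _ from hPd, show deriv h u = _ from hhd]
      simp only [hP, hh, hA, hB, hk]; push_cast; ring
    rw [h2, mul_eq_zero, or_iff_right Complex.I_ne_zero, mul_eq_zero,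
      or_iff_left (completingFactor_ne_zero hu)]
  refine (exists_isZeroTrajectory_iff_hasZeroGerm (p := (· = 0)) (q := (0 < ·))
    (p' := (· = 1 / 2)) (q' := (· < 1 / 2)) hre ?_ hzero ?_ ?_).trans
    ((hasZeroGerm_iff_hasZeroGerm_critical hPa hha hka hPs hhs hPord hk0).trans
    (exists_isZeroTrajectory_iff_hasZeroGerm (p := (· < 0)) (q := (0 < ·))
    (p' := (1 / 2 < ·)) (q' := (· < 1 / 2)) hre ?_ hcrit ?_ ?_).symm)
  · filter_upwards [himev] with s hs τ
    exact analyticAt_zetaFamily hψ hs τ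
  · exact fun y => ⟨fun e => by linarith, fun e => by linarith⟩
  · exact fun y => ⟨fun e => by linarith, fun e => by linarith⟩
  · filter_upwards [himev] with s hs τ
    exact (analyticAt_zetaFamily hψ hs τ).deriv
  · exact fun y => ⟨fun e => by linarith, fun e => by linarith⟩
  · exact fun y => ⟨fun e => by linarith, fun e => by linarith⟩
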